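/- **Conventions.** Let $\mathbb Z_-=\{n\in\mathbb Z: n\le 0\}$. All $\sigma$-fields on a probability space are completed and are essentially separable. A filtration is a non-decreasing family of sub-$\sigma$-fields indexed by $\mathbb Z_-$, or by an infinite subset $D\subset\mathbb Z_-$ (which is order-isomorphic to $\mathbb Z_-$). The natural filtration of a process $Z=(Z_n)$ is $\mathcal F^Z_n=\sigma(Z_k: k\le n)$. * A filtration is *of product type* if it is the natural filtration of a process made of independent random variables. * A filtration $\mathcal F$ is *immersed* in a filtration $\mathcal G$ on the same probability space if, for every index $n$, $\mathcal F_n\subset\mathcal G_n$ and $\mathcal F_n$ is independent of $\mathcal G_{n^-}$ conditionally on $\mathcal F_{n^-}$, where $n^-$ is the index that immediately precedes $n$. * An *isomorphism* from a filtration $\mathcal F$ on $(\Omega,\mathcal A,\mathbb P)$ onto a filtration $\mathcal F'$ on $(\Omega',\mathcal A',\mathbb P')$ is a bijection $\Psi:L^0(\Omega,\mathcal F_\infty,\mathbb P)\to L^0(\Omega',\mathcal F'_\infty,\mathbb P')$, where $\mathcal F_\infty=\bigvee_n\mathcal F_n$ and $\mathcal F'_\infty=\bigvee_n\mathcal F'_n$,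 that preserves the laws of random variables, commutes with Borel functions of sequences of random variables, and is such that, for every $n$, the variables $\Psi(X)$ with $X\in L^0(\Omega,\mathcal F_n,\mathbb P)$ generate $\mathcal F'_n$. * A filtration is *standard* if it is isomorphic to a filtration, on some probability space, that is immersed in a filtration of product type. * Given positive integers $(r_n)_{n\le0}$, a filtration $(\mathcal F_n)_{n\le 0}$ is *$(r_n)$-adic* if, for every $n\le 0$, $\mathcal F_n$ is generated by $\mathcal F_{n-1}$ and some random variable $U_n$ that is independent of $\mathcal F_{n-1}$ and uniformly distributed on a finite set with $r_n$ elements. * A filtration $(\mathcal F_n)_{n\le0}$ is *at the threshold of standardness* if it is not standard and, for every infinite $D\subset\mathbb Z_-$, the extracted filtration $(\mathcal F_n)_{n\in D}$ is standard if and only if $\mathbb Z_-\setminus D$ is infinite. **Theorem.** There exists an (inhomogeneous) Markov process $(Z_n)_{n\le 0}$ on some probability space such that 1. for each $n\le0$, $Z_n$ takes its values in some finite set $F_n$; 2. the random variables $(Z_{2n})_{n\le0}$ are independent; 3. for each $n\le0$, $Z_{2n-1}$ is a deterministic function of $(Z_{2n-2},Z_{2n})$; 4. the natural filtration $(\mathcal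 F^Z_n)_{n\le0}$ is $(r_n)_{n\le0}$-adic for some sequence $(r_n)_{n\le0}$ of positive integers; 5. for every infinite subset $D$ of $\mathbb Z_-$, the filtration $(\mathcal F^Z_n)_{n\in D}$ is standard if and only if $2n-1\notin D$ for infinitely many $n\le 0$. In particular, the filtration $(\mathcal F^Z_{2n-1})_{n\le0}$ is at the threshold of standardness. -/

import Mathlib

open MeasureTheory ProbabilityTheory

namespace BackwardFiltration

/-- The index set `ℤ₋ = {n ∈ ℤ : n ≤ 0}`, with the order inherited from `ℤ`. -/
abbrev NonposInt : Type := {n : ℤ // n ≤ 0}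

/-- The index `n - 1`. -/
def NonposInt.prev (n : NonposInt) : NonposInt := ⟨n.1 - 1, by have := n.2; omega⟩

/-- The even index `2n`. -/
def NonposInt.even (n : NonposInt) : NonposInt := ⟨2 * n.1, by have := n.2; omega⟩

/-- The even index `2n - 2`. -/
def NonposInt.evenPrev (n : NonposInt) : NonposInt := ⟨2 * n.1 - 2, by have := n.2; omega⟩

/-- The odd index `2n - 1`. -/
def NonposInt.odd (n : NonposInt) : NonposInt := ⟨2 * n.1 - 1, by have := n.2; omega⟩

theorem NonposInt.odd_mono : Monotone NonposInt.odd := by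
  intro a b h
  have h' : a.1 ≤ b.1 := h
  change 2 * a.1 - 1 ≤ 2 * b.1 - 1
  omega

section Completion

variable {Ω : Type*} {m0 : MeasurableSpace Ω}

/-- The completion of `m` in the ambient σ-field: the σ-field of all events which are almost surely
equal to an event of `m`. For `m ≤ m0` it is generated by `m` and the negligible events. -/
@[reducible] def completion (μ : Measure Ω) (m : MeasurableSpace Ω) : MeasurableSpace Ω :=
  eventuallyMeasurableSpace m (ae μ) ⊓ m0

theorem measurableSet_completion_iff {μ : Measure Ω} {m : MeasurableSpace Ω} {s : Set Ω} :
    MeasurableSet[completion μ m] s ↔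
      (∃ t, MeasurableSet[m] t ∧ s =ᵐ[μ] t) ∧ MeasurableSet[m0] s := by
  exact MeasurableSpace.measurableSet_inf

theorem completion_mono {μ : Measure Ω} {m₁ m₂ : MeasurableSpace Ω} (h : m₁ ≤ m₂) :
    completion μ m₁ ≤ completion μ m₂ := by
  intro s hs
  rw [measurableSet_completion_iff] at hs ⊢
  obtain ⟨⟨t, ht, hst⟩, hs⟩ := hs
  exact ⟨⟨t, h t ht, hst⟩, hs⟩

theorem completion_le {μ : Measure Ω} {m : MeasurableSpace Ω} : completion μ m ≤ m0 :=
  inf_le_right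

end Completion

section Filtrations

variable {Ω : Type*} {m0 : MeasurableSpace Ω} {ι κ : Type*}

/-- The (completed) natural filtration of a process `Z`:
at time `i` it is the completion of `σ(Z_j : j ≤ i)`. -/
def naturalFiltration [Preorder ι] {E : ι → Type*} [∀ i, MeasurableSpace (E i)]
    (μ : Measure Ω) (Z : ∀ i, Ω → E i) : Filtration ι m0 where
  seq i := completion μ (⨆ j, ⨆ (_ : j ≤ i), MeasurableSpace.comap (Z j) inferInstance)
  mono' _ _ hik := completion_mono
    (iSup₂_mono' fun j hj => ⟨j, hj.trans hik, le_rfl⟩)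
  le' _ := completion_le

/-- The filtration `(ℱ_{f k})_k` read along a monotone map `f` of index sets. -/
def reindex [Preorder ι] [Preorder κ] (ℱ : Filtration ι m0) (f : κ → ι) (hf : Monotone f) :
    Filtration κ m0 where
  seq k := ℱ (f k)
  mono' _ _ h := ℱ.mono' (hf h)
  le' k := ℱ.le' (f k)

/-- The extracted filtration `(ℱ_n)_{n ∈ D}`, indexed by `D` itself. -/
def extract [Preorder ι] (ℱ : Filtration ι m0) (D : Set ι) : Filtration D m0 :=
  reindex ℱ (Subtype.val : D → ι) (Subtype.mono_coe D)

end Filtrations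

section Standardness

/-- Conditional independence of the σ-fields `m₁` and `m₂` given the σ-field `m`.
(Mathlib's notion is restricted to standard Borel spaces, where it is equivalent to this one.) -/
def CondIndepGiven {Ω : Type*} {m0 : MeasurableSpace Ω} (μ : Measure Ω)
    (m m₁ m₂ : MeasurableSpace Ω) : Prop :=
  ∀ s t : Set Ω, MeasurableSet[m₁] s → MeasurableSet[m₂] t →
    μ⟦s ∩ t | m⟧ =ᵐ[μ] μ⟦s | m⟧ * μ⟦t | m⟧

/-- `ℱ` is immersed into `𝒢`: `ℱ_n ⊆ 𝒢_n` for every `n`, and `ℱ_n` is independent of `𝒢_k`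
conditionally on `ℱ_k` when `k` is the index that immediately precedes `n`. -/
def IsImmersed {Ω ι : Type*} {m0 : MeasurableSpace Ω} [Preorder ι] (μ : Measure Ω)
    (ℱ 𝒢 : Filtration ι m0) : Prop :=
  (∀ n, ℱ n ≤ 𝒢 n) ∧ ∀ k n, k ⋖ n → CondIndepGiven μ (ℱ k) (ℱ n) (𝒢 k)

/-- `𝒢` is of product type: it is the natural filtration of a process made of independent
random variables. (Real values: every σ-field is essentially separable.) -/
def IsProductType {Ω ι : Type*} {m0 : MeasurableSpace Ω} [Preorder ι] (μ : Measure Ω)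
    (𝒢 : Filtration ι m0) : Prop :=
  ∃ V : ι → Ω → ℝ, (∀ i, Measurable (V i)) ∧ iIndepFun V μ ∧ 𝒢 = naturalFiltration μ V

/-- `L⁰(Ω, m, μ)`: the classes, up to almost sure equality, of real random variables having an
`m`-measurable representative. -/
def L0 {Ω : Type*} (m : MeasurableSpace Ω) {m0 : MeasurableSpace Ω} (μ : Measure Ω) :
    Set (Ω →ₘ[μ] ℝ) :=
  {X | AEStronglyMeasurable[m] X μ}

/-- An isomorphism of filtered probability spaces: a bijection from `L⁰(ℱ_∞)` onto `L⁰(ℱ'_∞)`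
which preserves the laws, commutes with Borel functions of sequences of random variables, and sends
`ℱ` to `ℱ'`, that is to say, for every `i` the images of the elements of `L⁰(ℱ_i)` generate the
complete σ-field `ℱ'_i`. -/
structure FiltrationIso {Ω Ω' ι : Type*} {m0 : MeasurableSpace Ω} {m0' : MeasurableSpace Ω'}
    [Preorder ι] (μ : Measure Ω) (μ' : Measure Ω')
    (ℱ : Filtration ι m0) (ℱ' : Filtration ι m0') where
  toEquiv : L0 (⨆ i, ℱ i) μ ≃ L0 (⨆ i, ℱ' i) μ'
  map_law : ∀ X, μ'.map ((toEquiv X).1 : Ω' → ℝ) = μ.map (X.1 : Ω → ℝ)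
  comm_borel : ∀ (X : ℕ → L0 (⨆ i, ℱ i) μ) (Y : L0 (⨆ i, ℱ i) μ) (f : (ℕ → ℝ) → ℝ),
    Measurable f → (∀ᵐ ω ∂μ, Y.1 ω = f fun k => (X k).1 ω) →
      ∀ᵐ ω ∂μ', (toEquiv Y).1 ω = f fun k => (toEquiv (X k)).1 ω
  generate : ∀ i, completion μ'
    (⨆ X : L0 (⨆ i, ℱ i) μ, ⨆ (_ : X.1 ∈ L0 (ℱ i) μ),
      MeasurableSpace.comap ((toEquiv X).1 : Ω' → ℝ) (borel ℝ)) = ℱ' i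

/-- `ℱ` is standard: it is immersible into a filtration of product type, that is, on some
probability space there are a filtration of product type and a filtration isomorphic to `ℱ` that is
immersed into it. -/
def IsStandard {Ω ι : Type*} {m0 : MeasurableSpace Ω} [Preorder ι] (μ : Measure Ω)
    (ℱ : Filtration ι m0) : Prop :=
  ∃ (Ω' : Type) (m0' : MeasurableSpace Ω') (μ' : Measure Ω') (ℱ' 𝒢' : Filtration ι m0'),
    IsProbabilityMeasure μ' ∧ Nonempty (FiltrationIso μ μ' ℱ ℱ') ∧
      IsImmersed μ' ℱ' 𝒢' ∧ IsProductType μ' 𝒢'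

/-- `ℱ` is at the threshold of standardness: it is not standard, and an extracted filtration
`(ℱ_n)_{n ∈ D}` is standard exactly when infinitely many integers are skipped. -/
def IsAtThreshold {Ω : Type*} {m0 : MeasurableSpace Ω} (μ : Measure Ω)
    (ℱ : Filtration NonposInt m0) : Prop :=
  ¬ IsStandard μ ℱ ∧
    ∀ D : Set NonposInt, D.Infinite → (IsStandard μ (extract ℱ D) ↔ Dᶜ.Infinite)

end Standardness

section Processes

variable {Ω : Type*} {m0 : MeasurableSpace Ω}

/-- The (inhomogeneous) Markov property of a process indexed by `ℤ₋`: the conditional law of `Z_n`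
given the past up to time `n - 1` is its conditional law given `Z_{n-1}`. -/
def IsMarkov {E : NonposInt → Type*} [∀ n, MeasurableSpace (E n)]
    (μ : Measure Ω) (Z : ∀ n, Ω → E n) : Prop :=
  ∀ (n : NonposInt) (B : Set (E n)), MeasurableSet B →
    μ⟦Z n ⁻¹' B | naturalFiltration μ Z n.prev⟧
      =ᵐ[μ] μ⟦Z n ⁻¹' B | MeasurableSpace.comap (Z n.prev) inferInstance⟧

/-- `ℱ` is `(r_n)`-adic: for every `n`, `ℱ_n` is generated by `ℱ_{n-1}` and a random variable
independent of `ℱ_{n-1}` and uniform on a finite set with `r_n` elements. -/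
def IsAdicFiltration (μ : Measure Ω) (ℱ : Filtration NonposInt m0) (r : NonposInt → ℕ) : Prop :=
  ∀ n : NonposInt, 0 < r n ∧ ∃ U : Ω → Fin (r n), Measurable U ∧
    (∀ i, μ (U ⁻¹' {i}) = (r n : ENNReal)⁻¹) ∧
    Indep (MeasurableSpace.comap U inferInstance) (ℱ n.prev) μ ∧
    ℱ n = completion μ (ℱ n.prev ⊔ MeasurableSpace.comap U inferInstance)

end Processes

end BackwardFiltration

open BackwardFiltration

open Filter Set
open scoped ENNReal NNReal Topology

namespace BackwardFiltration

/-! ### Replacing the remote past of a product space by an independent copy -/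

section Splice

/-! Each rank k carries two independent uniform letters x_k, y_k in a field with 2^(k+4) elements.
Time -2k shows the pair (x_k, y_k). Time -2k-1 shows the preceding pair (x_{k+1}, y_{k+1}) and the
hint h_k = y_k - ψ(x_k), where the function ψ is chosen by the preceding pair. Different pairs
choose functions which agree, up to any constant, at no more than four points (`exists_code`). Each
step brings one fresh uniform letter, h_k or x_k, and this gives the Markov and adic properties.

Suppose that infinitely many odd times are skipped. At a skipped rank, y_k may serve as innovation
in place of h_k, and the innovations remain independent (`iIndepFun_innovation`). Every pair is then
computed from finitely many innovations, starting at a skipped rank in its past, so the process and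
the innovations generate the same σ-fields (`past_eq_innovationPast`). The extracted filtration is
of product type.

Suppose that only finitely many are skipped, and that the filtration is, up to isomorphism, immersed
in one generated by independent variables V. Pairs and hints become functions of V. Replace V up to
a remote time by an independent copy. As long as the old and new pairs of rank k+1 differ, the two
pairs of rank k can coincide only at one of at most four values, while immersion ensures that, given
the whole past of V, the pair of rank k is uniform over all the values compatible with its hint.
Hence a meeting at rank k has probability at most 4/2^(k+4), which is summable
(`measure_splice_step`), and the two copies of a fixed pair differ with probability at least 1/2
however remote the replacement. But a measurable function of V is hardly affected by a very remote
replacement (`tendsto_measure_splice`): a contradiction (`false_of_innovations`,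
`not_isStandard_of_two_stages`). -/

theorem apply_eq_of_measurable_cylinderEvents {ι : Type*} {s : Set ι} {E : Type*}
    [MeasurableSpace E] [MeasurableSingletonClass E] {f : (ι → ℝ) → E} (hf : Measurable[cylinderEvents s] f)
    {v w : ι → ℝ} (h : ∀ d ∈ s, v d = w d) : f v = f w := by
  let p : (ι → ℝ) → (s → ℝ) := fun v d => v d
  have hle : cylinderEvents s ≤ MeasurableSpace.comap p inferInstance := by
    refine iSup₂_le fun d hd => ?_
    rw [← measurable_iff_comap_le]
    exact (measurable_pi_apply (⟨d, hd⟩ : s)).comp (comap_measurable p)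
  obtain ⟨T, -, hT⟩ := hle _ (hf (measurableSet_singleton (f w)))
  have hw : w ∈ p ⁻¹' T := by rw [hT]; rfl
  have hv : v ∈ p ⁻¹' T := by
    have : p v = p w := funext fun d => h d d.2
    rw [mem_preimage, this]; exact hw
  rw [hT] at hv
  exact hv

variable {ι : Type*} [LinearOrder ι]

open Classical in
/-- The configuration which coincides with `w` up to the index `t` and with `v` afterwards. -/
def splice (t : ι) (v w : ι → ℝ) : ι → ℝ := fun d => if d ≤ t then w d else v d

theorem splice_of_le {t d : ι} (h : d ≤ t) (v w : ι → ℝ) : splice t v w d = w d := if_pos h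

theorem splice_of_not_le {t d : ι} (h : ¬ d ≤ t) (v w : ι → ℝ) : splice t v w d = v d := if_neg h

theorem measurable_splice (t : ι) :
    Measurable fun p : (ι → ℝ) × (ι → ℝ) => splice t p.1 p.2 := by
  refine measurable_pi_iff.2 fun d => ?_
  by_cases h : d ≤ t
  · simp only [splice_of_le h]; fun_prop
  · simp only [splice_of_not_le h]; fun_prop

theorem measurable_cylinderEvents_splice_left {s : Set ι} (t : ι) (w : ι → ℝ) :
    Measurable[cylinderEvents s, cylinderEvents s] fun v : ι → ℝ => splice t v w := by
  rw [measurable_cylinderEvents_iff]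
  intro d hd
  by_cases h : d ≤ t
  · simp only [splice_of_le h]; exact measurable_const
  · simp only [splice_of_not_le h]; exact measurable_cylinderEvent_apply hd

variable (ν : ι → Measure ℝ) [∀ i, IsProbabilityMeasure (ν i)]

/-- The coordinates taken from the two copies form complementary sets, so a box pulls back to a
product of two boxes whose measures multiply to that of the box. -/
theorem measurePreserving_splice (t : ι) :
    MeasurePreserving (fun p : (ι → ℝ) × (ι → ℝ) => splice t p.1 p.2)
      ((Measure.infinitePi ν).prod (Measure.infinitePi ν)) (Measure.infinitePi ν) := by
  classical
  refine ⟨measurable_splice t, Measure.eq_infinitePi _ fun s A hA => ?_⟩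
  have hpre : (fun p : (ι → ℝ) × (ι → ℝ) => splice t p.1 p.2) ⁻¹' ((s : Set ι).pi A) =
      (((s.filter fun d => ¬ d ≤ t : Finset ι) : Set ι).pi A) ×ˢ
        (((s.filter fun d => d ≤ t : Finset ι) : Set ι).pi A) := by
    ext ⟨v, w⟩
    simp only [mem_preimage, Set.mem_pi, mem_prod, Finset.mem_coe, Finset.mem_filter]
    constructor
    · intro h
      exact ⟨fun d hd => by simpa [splice_of_not_le hd.2] using h d hd.1,
        fun d hd => by simpa [splice_of_le hd.2] using h d hd.1⟩
    · rintro ⟨h₁, h₂⟩ d hd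
      by_cases h : d ≤ t
      · rw [splice_of_le h]; exact h₂ d ⟨hd, h⟩
      · rw [splice_of_not_le h]; exact h₁ d ⟨hd, h⟩
  rw [Measure.map_apply (measurable_splice t)
    (MeasurableSet.pi s.countable_toSet fun i _ => hA i), hpre, Measure.prod_prod,
    Measure.infinitePi_pi _ (fun i _ => hA i), Measure.infinitePi_pi _ (fun i _ => hA i), mul_comm,
    Finset.prod_filter_mul_prod_filter_not]

/-- The sets with this property form a σ-field containing the events about one coordinate, which is
eventually left untouched. For a countable union, a finite partial union misses little mass, and the
same bound holds after splicing, for all `N` at once, because splicing preserves the law. -/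
theorem tendsto_measure_splice {t : ℕ → ι} (ht : ∀ i, ∀ᶠ N in atTop, ¬ i ≤ t N)
    {S : Set (ι → ℝ)} (hS : MeasurableSet S) :
    Tendsto (fun N => ((Measure.infinitePi ν).prod (Measure.infinitePi ν))
      {p | ¬ (p.1 ∈ S ↔ splice (t N) p.1 p.2 ∈ S)}) atTop (𝓝 0) := by
  set P := Measure.infinitePi ν
  let 𝓜 : MeasurableSpace (ι → ℝ) :=
    { MeasurableSet' := fun S => MeasurableSet S ∧ Tendsto (fun N => (P.prod P)
        {p | ¬ (p.1 ∈ S ↔ splice (t N) p.1 p.2 ∈ S)}) atTop (𝓝 0)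
      measurableSet_empty := ⟨.empty, by simp⟩
      measurableSet_compl := fun S hS => ⟨hS.1.compl, by simpa [not_iff_not] using hS.2⟩
      measurableSet_iUnion := by
        intro S hS
        have hSm i := (hS i).1
        refine ⟨.iUnion hSm, ?_⟩
        rw [ENNReal.tendsto_nhds_zero]
        intro ε hε
        have hε3 : 0 < ε / 3 := by simpa using hε.ne'
        let R : ℕ → Set (ι → ℝ) := fun n => (⋃ i, S i) \ accumulate S n
        have hacc n : MeasurableSet (accumulate S n) :=
          .biUnion (to_countable _) fun i _ => hSm i
        have hRm n : MeasurableSet (R n) := (MeasurableSet.iUnion hSm).diff (hacc n)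
        have hR : Tendsto (fun n => P (R n)) atTop (𝓝 0) := by
          have h := tendsto_measure_iInter_atTop (μ := P) (s := R)
            (fun n => (hRm n).nullMeasurableSet)
            (fun m n hmn => sdiff_subset_sdiff_right (monotone_accumulate hmn))
            ⟨0, measure_ne_top _ _⟩
          have h0 : ⋂ n, R n = ∅ := by
            rw [← sdiff_iUnion, iUnion_accumulate, sdiff_self]
          rwa [h0, measure_empty] at h
        obtain ⟨n, hn⟩ := (ENNReal.tendsto_nhds_zero.1 hR _ hε3).exists
        have hsum : Tendsto (fun N => ∑ i ∈ Finset.range (n + 1), (P.prod P)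
            {p | ¬ (p.1 ∈ S i ↔ splice (t N) p.1 p.2 ∈ S i)}) atTop (𝓝 0) := by
          simpa using tendsto_finsetSum (Finset.range (n + 1)) fun i _ => (hS i).2
        filter_upwards [ENNReal.tendsto_nhds_zero.1 hsum _ hε3] with N hN
        have hsub : {p : (ι → ℝ) × (ι → ℝ) |
              ¬ (p.1 ∈ ⋃ i, S i ↔ splice (t N) p.1 p.2 ∈ ⋃ i, S i)} ⊆
            (⋃ i ∈ Finset.range (n + 1), {p | ¬ (p.1 ∈ S i ↔ splice (t N) p.1 p.2 ∈ S i)}) ∪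
              (Prod.fst ⁻¹' R n ∪ (fun p => splice (t N) p.1 p.2) ⁻¹' R n) := by
          intro p hp
          by_contra hcon
          simp only [mem_union, mem_iUnion, Finset.mem_range, mem_ofPred_eq, exists_prop, not_or,
            not_exists, not_and, not_not, mem_preimage, R, Set.mem_sdiff, mem_accumulate] at hcon hp
          obtain ⟨h1, h2, h3⟩ := hcon
          apply hp
          constructor
          · intro h
            by_contra hno
            exact h2 h fun i hi hpi => hno ⟨i, (h1 i (by omega)).1 hpi⟩
          · intro h
            by_contra hno
            exact h3 h fun i hi hpi => hno ⟨i, (h1 i (by omega)).2 hpi⟩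
        calc (P.prod P) _ ≤ _ := measure_mono hsub
          _ ≤ ε / 3 + (ε / 3 + ε / 3) := by
            refine (measure_union_le _ _).trans (add_le_add
              ((measure_biUnion_finset_le _ _).trans hN) ((measure_union_le _ _).trans
                (add_le_add ?_ ?_)))
            · rw [measurePreserving_fst.measure_preimage (hRm n).nullMeasurableSet]
              exact hn
            · rw [(measurePreserving_splice ν (t N)).measure_preimage (hRm n).nullMeasurableSet]
              exact hn
          _ = ε := by rw [← add_assoc, ENNReal.add_thirds] }
  have hle : (MeasurableSpace.pi : MeasurableSpace (ι → ℝ)) ≤ 𝓜 := by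
    refine iSup_le fun i => ?_
    rintro _ ⟨A, hA, rfl⟩
    refine ⟨measurable_pi_apply i hA, ?_⟩
    refine tendsto_const_nhds.congr' ?_
    filter_upwards [ht i] with N hN
    simp [splice_of_not_le hN]
  exact (hle S hS).2

/-- If the earlier states differ and the later ones meet, the common value solves two equations.
Given the past up to `t`, each solution of the first is taken with probability `c`, and few of them
solve the second. -/
theorem measure_splice_step {τ t : ι} {X' X Y : Type*} [Fintype X]
    [MeasurableSpace X'] [MeasurableSpace X] [MeasurableSpace Y] [Countable X'] [Countable Y]
    [DiscreteMeasurableSpace X'] [DiscreteMeasurableSpace X] [DiscreteMeasurableSpace Y]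
    {α' : (ι → ℝ) → X'} {α : (ι → ℝ) → X} {β : (ι → ℝ) → Y} {g : X' → X → Y} {c ε : ℝ≥0∞}
    (hα' : Measurable[cylinderEvents (Iic t)] α') (hα : Measurable α)
    (hβ : Measurable[cylinderEvents (Iic t)] β)
    (hg : ∀ᵐ v ∂Measure.infinitePi ν, β v = g (α' v) (α v))
    (hlaw : ∀ x S, MeasurableSet[cylinderEvents (Iic t)] S →
      Measure.infinitePi ν ({v | α v = x} ∩ S) =
        c * Measure.infinitePi ν (S ∩ {v | g (α' v) x = β v}))
    (hg' : ∀ x x' y y', x ≠ x' → c * ({z | g x z = y ∧ g x' z = y'}.ncard : ℝ≥0∞) ≤ ε) :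
    ((Measure.infinitePi ν).prod (Measure.infinitePi ν))
        {p | α p.1 = α (splice τ p.1 p.2)} ≤
      ((Measure.infinitePi ν).prod (Measure.infinitePi ν))
        {p | α' p.1 = α' (splice τ p.1 p.2)} + ε := by
  classical
  set P := Measure.infinitePi ν
  have hα'm : Measurable α' := hα'.mono cylinderEvents_le_pi le_rfl
  have hβm : Measurable β := hβ.mono cylinderEvents_le_pi le_rfl
  -- At a meeting, the later state of the spliced copy may be replaced by `α p.1`. The spliced copy
  -- then enters only through variables of the past up to `t`.
  let D : Set ((ι → ℝ) × (ι → ℝ)) := {p | α' p.1 ≠ α' (splice τ p.1 p.2) ∧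
    g (α' (splice τ p.1 p.2)) (α p.1) = β (splice τ p.1 p.2)}
  have hD : MeasurableSet D := by
    have h : Measurable fun p : (ι → ℝ) × (ι → ℝ) => ((α' p.1, α p.1),
        (α' (splice τ p.1 p.2), β (splice τ p.1 p.2))) :=
      ((hα'm.comp measurable_fst).prodMk (hα.comp measurable_fst)).prodMk
        ((hα'm.comp (measurable_splice τ)).prodMk (hβm.comp (measurable_splice τ)))
    exact h (MeasurableSet.of_discrete
      (s := {q : (X' × X) × (X' × Y) | q.1.1 ≠ q.2.1 ∧ g q.2.1 q.1.2 = q.2.2}))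
  have hDε : (P.prod P) D ≤ ε := by
    -- With `w` frozen, each `T z` is an event of the past of `v` up to `t`, to which `hlaw`
    -- applies.
    rw [Measure.prod_apply_symm hD]
    refine (lintegral_mono (g := fun _ => ε) fun w => ?_).trans (by simp)
    let T : X → Set (ι → ℝ) := fun z =>
      {v | α' v ≠ α' (splice τ v w) ∧ g (α' (splice τ v w)) z = β (splice τ v w)}
    have hTg z : MeasurableSet[cylinderEvents (Iic t)] (T z) ∧
        MeasurableSet[cylinderEvents (Iic t)] (T z ∩ {v | g (α' v) z = β v}) := by
      have h : Measurable[cylinderEvents (Iic t)] fun v : ι → ℝ => ((α' v, β v),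
          (α' (splice τ v w), β (splice τ v w))) :=
        (hα'.prodMk hβ).prodMk
          ((hα'.comp (measurable_cylinderEvents_splice_left τ w)).prodMk
            (hβ.comp (measurable_cylinderEvents_splice_left τ w)))
      exact ⟨h (MeasurableSet.of_discrete
          (s := {q : (X' × Y) × (X' × Y) | q.1.1 ≠ q.2.1 ∧ g q.2.1 z = q.2.2})),
        h (MeasurableSet.of_discrete (s := {q : (X' × Y) × (X' × Y) |
          (q.1.1 ≠ q.2.1 ∧ g q.2.1 z = q.2.2) ∧ g q.1.1 z = q.1.2}))⟩
    have hsub : (fun v => (v, w)) ⁻¹' D ⊆ ⋃ z ∈ (Finset.univ : Finset X), {v | α v = z} ∩ T z := by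
      intro v hv
      simp only [mem_iUnion]
      exact ⟨α v, Finset.mem_univ _, rfl, hv⟩
    calc P ((fun v => (v, w)) ⁻¹' D)
        ≤ ∑ z, P ({v | α v = z} ∩ T z) :=
          (measure_mono hsub).trans (measure_biUnion_finset_le _ _)
      _ = ∑ z, c * P (T z ∩ {v | g (α' v) z = β v}) :=
          Finset.sum_congr rfl fun z _ => hlaw z _ (hTg z).1
      _ = ∑ z, ∫⁻ v, (T z ∩ {v | g (α' v) z = β v}).indicator (fun _ => c) v ∂P := by
          refine Finset.sum_congr rfl fun z _ => ?_
          rw [lintegral_indicator_const (cylinderEvents_le_pi _ (hTg z).2)]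
      _ = ∫⁻ v, ∑ z, (T z ∩ {v | g (α' v) z = β v}).indicator (fun _ => c) v ∂P := by
          rw [lintegral_finsetSum]
          exact fun z _ => measurable_const.indicator (cylinderEvents_le_pi _ (hTg z).2)
      _ ≤ ∫⁻ _, ε ∂P := by
          refine lintegral_mono fun v => ?_
          by_cases hne : α' v = α' (splice τ v w)
          · simp [T, hne]
          · refine le_trans (le_of_eq ?_) (hg' (α' v) (α' (splice τ v w)) (β v)
              (β (splice τ v w)) hne)
            simp only [indicator_apply, T, mem_inter_iff, mem_ofPred_eq, ne_eq, hne,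
              not_false_eq_true, true_and]
            rw [← Finset.sum_filter, Finset.sum_const, nsmul_eq_mul, mul_comm,
              Set.ncard_eq_toFinset_card']
            congr 3
            ext z
            simp [and_comm]
      _ = ε := by simp
  have hg2 := (measurePreserving_splice ν τ).quasiMeasurePreserving.ae hg
  calc (P.prod P) {p | α p.1 = α (splice τ p.1 p.2)}
      ≤ (P.prod P) ({p | α' p.1 = α' (splice τ p.1 p.2)} ∪ D) := by
        refine measure_mono_ae ?_
        filter_upwards [hg2] with p hp h
        by_cases h' : α' p.1 = α' (splice τ p.1 p.2)
        · exact Or.inl h'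
        · exact Or.inr ⟨h', by rw [show α p.1 = _ from h]; exact hp.symm⟩
    _ ≤ _ := (measure_union_le _ _).trans (add_le_add le_rfl hDε)

theorem measure_apply_eq_apply_le {R X : Type*} [MeasurableSpace R] [MeasurableSpace X]
    [Countable X] [DiscreteMeasurableSpace X] {P : Measure R} [IsProbabilityMeasure P]
    {α : R → X} (hα : Measurable α) {δ : ℝ≥0∞} (h : ∀ x, P {v | α v = x} ≤ δ) :
    (P.prod P) {p | α p.1 = α p.2} ≤ δ := by
  have hm : MeasurableSet {p : R × R | α p.1 = α p.2} :=
    ((hα.comp measurable_fst).prodMk (hα.comp measurable_snd)) (MeasurableSet.of_discrete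
      (s := {q : X × X | q.1 = q.2}))
  rw [Measure.prod_apply_symm hm]
  exact (lintegral_mono (g := fun _ => δ) fun w => h (α w)).trans (by simp)

/-- A process of finite-valued variables cannot be a function of independent innovations if any
two copies of it whose states differ at some time are unlikely to meet afterwards. -/
theorem false_of_innovations {t : ℕ → ι}
    (hcof : ∀ i, ∀ᶠ N in atTop, ¬ i ≤ t N)
    {X Y : ℕ → Type*} [∀ k, Fintype (X k)] [∀ k, Countable (Y k)]
    [∀ k, MeasurableSpace (X k)] [∀ k, MeasurableSpace (Y k)]
    [∀ k, DiscreteMeasurableSpace (X k)] [∀ k, DiscreteMeasurableSpace (Y k)]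
    {α : ∀ k, (ι → ℝ) → X k} {β : ∀ k, (ι → ℝ) → Y k} {g : ∀ k, X (k + 1) → X k → Y k}
    {c ε δ : ℕ → ℝ≥0∞}
    (hα' : ∀ k, Measurable[cylinderEvents (Iic (t k))] (α (k + 1)))
    (hα : ∀ k, Measurable (α k))
    (hβ : ∀ k, Measurable[cylinderEvents (Iic (t k))] (β k))
    (hg : ∀ k, ∀ᵐ v ∂Measure.infinitePi ν, β k v = g k (α (k + 1) v) (α k v))
    (hlaw : ∀ k x S, MeasurableSet[cylinderEvents (Iic (t k))] S →
      Measure.infinitePi ν ({v | α k v = x} ∩ S) =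
        c k * Measure.infinitePi ν (S ∩ {v | g k (α (k + 1) v) x = β k v}))
    (hg' : ∀ k x x' y y', x ≠ x' →
      c k * ({z | g k x z = y ∧ g k x' z = y'}.ncard : ℝ≥0∞) ≤ ε k)
    (hδ : ∀ k x, Measure.infinitePi ν {v | α k v = x} ≤ δ k)
    {r : ℝ≥0∞} (hr : r < 1) (hεδ : ∀ N, δ (N + 1) + ∑ k ∈ Finset.range (N + 1), ε k ≤ r) :
    False := by
  set P := Measure.infinitePi ν
  -- After splicing at `t N`, the states of rank `N + 1` are independent copies, which costs `δ (N +
  -- 1)`; each rank below, down to `0`, adds `ε k`.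
  have hQ (N : ℕ) : (P.prod P) {p | α 0 p.1 = α 0 (splice (t N) p.1 p.2)} ≤ r := by
    have hstart : (P.prod P) {p | α (N + 1) p.1 = α (N + 1) (splice (t N) p.1 p.2)} ≤
        δ (N + 1) := by
      have : ∀ p : (ι → ℝ) × (ι → ℝ), α (N + 1) (splice (t N) p.1 p.2) = α (N + 1) p.2 :=
        fun p => apply_eq_of_measurable_cylinderEvents (hα' N) fun d hd => splice_of_le hd _ _
      simp only [this]
      exact measure_apply_eq_apply_le (hα (N + 1)) (hδ (N + 1))
    have hind : ∀ k ≤ N + 1, (P.prod P) {p | α 0 p.1 = α 0 (splice (t N) p.1 p.2)} ≤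
        (P.prod P) {p | α k p.1 = α k (splice (t N) p.1 p.2)} + ∑ j ∈ Finset.range k, ε j := by
      intro k
      induction k with
      | zero => simp
      | succ k ih =>
        intro hk
        refine (ih (by omega)).trans ?_
        rw [Finset.sum_range_succ, add_comm (∑ j ∈ Finset.range k, ε j), ← add_assoc]
        exact add_le_add (measure_splice_step ν (hα' k) (hα k) (hβ k) (hg k) (hlaw k)
          (hg' k)) le_rfl
    exact ((hind (N + 1) le_rfl).trans (add_le_add hstart le_rfl)).trans (hεδ N)
  -- In the other direction, the finitely many events `α 0 = x` are asymptotically insensitive to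
  -- the splice, so the two copies of `α 0` agree with probability tending to `1`.
  have hbad : Tendsto (fun N => ∑ x, (P.prod P)
      {p | ¬ (p.1 ∈ {v | α 0 v = x} ↔ splice (t N) p.1 p.2 ∈ {v | α 0 v = x})})
      atTop (𝓝 0) := by
    have h := tendsto_finsetSum (Finset.univ : Finset (X 0))
      fun x _ => tendsto_measure_splice ν hcof (hα 0 (measurableSet_singleton x))
    rw [Finset.sum_const_zero] at h
    exact h
  have hone (N : ℕ) : 1 ≤ r + ∑ x, (P.prod P)
      {p | ¬ (p.1 ∈ {v | α 0 v = x} ↔ splice (t N) p.1 p.2 ∈ {v | α 0 v = x})} := by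
    calc (1 : ℝ≥0∞) = (P.prod P) univ := measure_univ.symm
      _ ≤ (P.prod P) ({p | α 0 p.1 = α 0 (splice (t N) p.1 p.2)} ∪
          ⋃ x ∈ (Finset.univ : Finset (X 0)),
            {p | ¬ (p.1 ∈ {v | α 0 v = x} ↔ splice (t N) p.1 p.2 ∈ {v | α 0 v = x})}) := by
        refine measure_mono fun p _ => ?_
        by_cases h : α 0 p.1 = α 0 (splice (t N) p.1 p.2)
        · exact Or.inl h
        · refine Or.inr (mem_biUnion (Finset.mem_univ (α 0 p.1)) ?_)
          simpa [eq_comm] using h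
      _ ≤ _ := (measure_union_le _ _).trans
        (add_le_add (hQ N) (measure_biUnion_finset_le _ _))
  have hlim := ge_of_tendsto' (tendsto_const_nhds.add hbad) hone
  rw [add_zero] at hlim
  exact absurd hlim (not_le.2 hr)

end Splice

/-! ### Completed σ-fields -/

section Completion

variable {Ω : Type*} {m0 : MeasurableSpace Ω} {μ : Measure Ω} {m m₁ m₂ : MeasurableSpace Ω}

theorem le_completion (h : m ≤ m0) : m ≤ completion μ m := fun s hs =>
  measurableSet_completion_iff.2 ⟨⟨s, hs, EventuallyEq.rfl⟩, h s hs⟩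

theorem completion_completion : completion μ (completion μ m) = completion μ m := by
  refine le_antisymm ?_ (le_completion completion_le)
  intro s hs
  rw [measurableSet_completion_iff] at hs
  obtain ⟨⟨t, ht, hst⟩, hs⟩ := hs
  rw [measurableSet_completion_iff] at ht ⊢
  obtain ⟨⟨u, hu, htu⟩, -⟩ := ht
  exact ⟨⟨u, hu, hst.trans htu⟩, hs⟩

theorem completion_sup (h₁ : m₁ ≤ m0) (h₂ : m₂ ≤ m0) :
    completion μ (completion μ m₁ ⊔ m₂) = completion μ (m₁ ⊔ m₂) := by
  refine le_antisymm ?_ (completion_mono (sup_le_sup_right (le_completion h₁) _))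
  rw [← completion_completion (m := m₁ ⊔ m₂)]
  exact completion_mono (sup_le (completion_mono le_sup_left)
    (le_sup_right.trans (le_completion (sup_le h₁ h₂))))

theorem indep_completion_right (h : Indep m₁ m₂ μ) : Indep m₁ (completion μ m₂) μ := by
  rw [Indep_iff] at h ⊢
  intro s t hs ht
  obtain ⟨⟨u, hu, htu⟩, -⟩ := measurableSet_completion_iff.1 ht
  rw [measure_congr ((ae_eq_refl s).inter htu), measure_congr htu, h s u hs hu]

end Completion

/-! ### Discrete variables built from almost partitions -/

section Discrete

/-- A countable family of events which is almost a partition is almost the family of the fibres of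
a measurable map. -/
theorem exists_measurable_of_partition {Ω X : Type*} [Countable X] [Nonempty X] [MeasurableSpace X]
    [DiscreteMeasurableSpace X] {m : MeasurableSpace Ω} (S : X → Set Ω)
    (hS : ∀ x, MeasurableSet[m] (S x)) :
    ∃ f : Ω → X, Measurable[m] f ∧ ∀ ω, (∃! x, ω ∈ S x) → ∀ x, f ω = x ↔ ω ∈ S x := by
  classical
  let x₀ : X := Classical.arbitrary X
  let U : X → Set Ω := fun x => {ω | ω ∈ S x ∧ ∀ y, ω ∈ S y → y = x}
  have hU x : MeasurableSet[m] (U x) := by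
    have : U x = S x ∩ ⋂ y ∈ ({x}ᶜ : Set X), (S y)ᶜ := by
      ext ω
      simp only [U, mem_ofPred_eq, mem_inter_iff, mem_iInter, mem_compl_iff, mem_singleton_iff]
      exact and_congr_right fun _ => forall_congr' fun y => by tauto
    rw [this]
    exact (hS x).inter (.biInter (to_countable _) fun y _ => (hS y).compl)
  let f : Ω → X := fun ω => if h : ∃ x, ω ∈ U x then h.choose else x₀
  have hf {ω x} (hx : ω ∈ U x) : f ω = x := by
    have he : ∃ x, ω ∈ U x := ⟨x, hx⟩
    simp only [f, dif_pos he]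
    exact hx.2 _ he.choose_spec.1
  refine ⟨f, ?_, fun ω hω x => ?_⟩
  · refine measurable_to_countable' fun x => ?_
    have : f ⁻¹' {x} = U x ∪ ((⋃ y, U y)ᶜ ∩ {_ω | x = x₀}) := by
      ext ω
      simp only [mem_preimage, mem_singleton_iff, mem_union, mem_inter_iff, mem_compl_iff,
        mem_iUnion, mem_ofPred_eq]
      by_cases he : ∃ y, ω ∈ U y
      · obtain ⟨y, hy⟩ := he
        rw [hf hy]
        constructor
        · rintro rfl; exact Or.inl hy
        · rintro (hx | ⟨hn, -⟩)
          · exact hx.2 _ hy.1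
          · exact absurd ⟨y, hy⟩ hn
      · have : f ω = x₀ := dif_neg he
        rw [this]
        constructor
        · exact fun hx => Or.inr ⟨he, hx.symm⟩
        · rintro (hx | ⟨-, hx⟩)
          · exact absurd ⟨x, hx⟩ he
          · exact hx.symm
    rw [this]
    exact (hU x).union ((MeasurableSet.iUnion hU).compl.inter (MeasurableSet.const _))
  · obtain ⟨y, hy, hy'⟩ := hω
    have hyU : ω ∈ U y := ⟨hy, hy'⟩
    rw [hf hyU]
    exact ⟨fun h => h ▸ hy, fun h => (hy' x h).symm⟩

end Discrete

/-! ### Action of an isomorphism of filtrations on events -/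

section Transport

variable {Ω Ω' ι : Type*} {m0 : MeasurableSpace Ω} {m0' : MeasurableSpace Ω'} [Preorder ι]
  {μ : Measure Ω} {μ' : Measure Ω'} {ℱ : Filtration ι m0} {ℱ' : Filtration ι m0'}

theorem iSup_filtration_le (ℱ : Filtration ι m0) : ⨆ i, ℱ i ≤ m0 := iSup_le fun i => ℱ.le i

/-- The class of the indicator of the event `S`. -/
noncomputable def indicatorClass (μ : Measure Ω) (S : Set Ω) (hS : MeasurableSet S) : Ω →ₘ[μ] ℝ :=
  AEEqFun.mk (S.indicator 1) (measurable_one.indicator hS).aestronglyMeasurable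

theorem indicatorClass_ae_eq {S : Set Ω} (hS : MeasurableSet S) :
    indicatorClass μ S hS =ᵐ[μ] S.indicator 1 :=
  AEEqFun.coeFn_mk _ _

theorem aestronglyMeasurable_indicatorClass {m : MeasurableSpace Ω} (hm : m ≤ m0) {S : Set Ω}
    (hS : MeasurableSet[m] S) :
    AEStronglyMeasurable[m] (indicatorClass μ S (hm S hS) : Ω → ℝ) μ :=
  AEStronglyMeasurable.congr
    ((@stronglyMeasurable_one Ω ℝ m _ _).indicator hS).aestronglyMeasurable
    (indicatorClass_ae_eq (hm S hS)).symm

/-- The indicator of `S`, as an element of `L⁰`. -/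
noncomputable def indicatorL0 (μ : Measure Ω) {m : MeasurableSpace Ω} (hm : m ≤ m0) (S : Set Ω)
    (hS : MeasurableSet[m] S) : L0 m μ :=
  ⟨indicatorClass μ S (hm S hS), aestronglyMeasurable_indicatorClass hm hS⟩

theorem indicatorL0_ae_eq {m : MeasurableSpace Ω} (hm : m ≤ m0) {S : Set Ω}
    (hS : MeasurableSet[m] S) : (indicatorL0 μ hm S hS).1 =ᵐ[μ] S.indicator 1 :=
  indicatorClass_ae_eq (hm S hS)

theorem measurableSet_apply_eq_one (n : ℕ) : MeasurableSet {x : ℕ → ℝ | x n = 1} :=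
  measurableSet_eq_fun (measurable_pi_apply n) measurable_const

variable (Ψ : FiltrationIso μ μ' ℱ ℱ')

open Classical in
/-- The image of the event `S` by an isomorphism. -/
noncomputable def eventMap (S : Set Ω) : Set Ω' :=
  if hS : MeasurableSet[⨆ i, ℱ i] S then
    {ω | (Ψ.toEquiv (indicatorL0 μ (iSup_filtration_le ℱ) S hS)).1 ω = 1} else ∅

variable {Ψ}

theorem eventMap_eq {S : Set Ω} (hS : MeasurableSet[⨆ i, ℱ i] S) : eventMap Ψ S =
    {ω | (Ψ.toEquiv (indicatorL0 μ (iSup_filtration_le ℱ) S hS)).1 ω = 1} := dif_pos hS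

theorem measurableSet_eventMap (S : Set Ω) : MeasurableSet (eventMap Ψ S) := by
  by_cases hS : MeasurableSet[⨆ i, ℱ i] S
  · rw [eventMap_eq hS]
    exact (AEEqFun.measurable _) (measurableSet_singleton (1 : ℝ))
  · rw [eventMap, dif_neg hS]
    exact .empty

theorem measure_eventMap {S : Set Ω} (hS : MeasurableSet[⨆ i, ℱ i] S) :
    μ' (eventMap Ψ S) = μ S := by
  have h := congrArg (fun ρ => ρ {1})
    (Ψ.map_law (indicatorL0 μ (iSup_filtration_le ℱ) S hS))
  rw [Measure.map_apply (AEEqFun.measurable _) (measurableSet_singleton (1 : ℝ)),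
    Measure.map_apply (AEEqFun.measurable _) (measurableSet_singleton (1 : ℝ))] at h
  rw [eventMap_eq hS]
  refine h.trans (measure_congr ?_)
  filter_upwards [indicatorL0_ae_eq (μ := μ) (iSup_filtration_le ℱ) hS] with ω hω
  refine propext ?_
  change (indicatorL0 μ (iSup_filtration_le ℱ) S hS).1 ω = 1 ↔ ω ∈ S
  rw [hω]
  by_cases h : ω ∈ S <;> simp [h]

/-- The image of the event that a sequence of variables belongs to a Borel set. -/
theorem eventMap_ae_eq {S : Set Ω} (hS : MeasurableSet[⨆ i, ℱ i] S)
    (X : ℕ → L0 (⨆ i, ℱ i) μ) {B : Set (ℕ → ℝ)} (hB : MeasurableSet B)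
    (h : ∀ᵐ ω ∂μ, ω ∈ S ↔ (fun k => (X k).1 ω) ∈ B) :
    ∀ᵐ ω ∂μ', ω ∈ eventMap Ψ S ↔ (fun k => (Ψ.toEquiv (X k)).1 ω) ∈ B := by
  have := Ψ.comm_borel X (indicatorL0 μ (iSup_filtration_le ℱ) S hS) (B.indicator 1)
    (measurable_one.indicator hB) (by
      filter_upwards [h, indicatorL0_ae_eq (μ := μ) (iSup_filtration_le ℱ) hS] with ω hω hω'
      rw [hω']
      by_cases h : ω ∈ S
      · rw [indicator_of_mem h, indicator_of_mem (hω.1 h)]; rfl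
      · rw [indicator_of_notMem h, indicator_of_notMem (fun hn => h (hω.2 hn))])
  filter_upwards [this] with ω hω
  rw [eventMap_eq hS, mem_ofPred_eq, hω]
  by_cases h : (fun k => (Ψ.toEquiv (X k)).1 ω) ∈ B
  · simp [h]
  · simp [h]

theorem indicatorL0_mem_iff {S : Set Ω} (hS : MeasurableSet[⨆ i, ℱ i] S) :
    ∀ᵐ ω ∂μ, (indicatorL0 μ (iSup_filtration_le ℱ) S hS).1 ω = 1 ↔ ω ∈ S := by
  filter_upwards [indicatorL0_ae_eq (μ := μ) (iSup_filtration_le ℱ) hS] with ω hω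
  rw [hω]
  by_cases h : ω ∈ S <;> simp [h]

theorem eventMap_compl {S : Set Ω} (hS : MeasurableSet[⨆ i, ℱ i] S) :
    eventMap Ψ Sᶜ =ᵐ[μ'] (eventMap Ψ S)ᶜ := by
  have h := eventMap_ae_eq (Ψ := Ψ) hS.compl
    (fun _ => indicatorL0 μ (iSup_filtration_le ℱ) S hS) (B := {x | x 0 = 1}ᶜ)
    (measurableSet_apply_eq_one 0).compl (by
      filter_upwards [indicatorL0_mem_iff (μ := μ) hS] with ω hω
      simp only [mem_compl_iff, mem_ofPred_eq, hω])
  filter_upwards [h] with ω hω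
  refine propext (hω.trans ?_)
  rw [eventMap_eq hS]
  rfl

theorem eventMap_iUnion {S : ℕ → Set Ω} (hS : ∀ n, MeasurableSet[⨆ i, ℱ i] (S n)) :
    eventMap Ψ (⋃ n, S n) =ᵐ[μ'] ⋃ n, eventMap Ψ (S n) := by
  have h := eventMap_ae_eq (Ψ := Ψ) (MeasurableSet.iUnion hS)
    (fun n => indicatorL0 μ (iSup_filtration_le ℱ) (S n) (hS n)) (B := ⋃ n, {x | x n = 1})
    (.iUnion fun n => measurableSet_apply_eq_one n) (by
      filter_upwards [ae_all_iff.2 fun n => indicatorL0_mem_iff (μ := μ) (hS n)] with ω hω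
      simp only [mem_iUnion, mem_ofPred_eq, hω])
  filter_upwards [h] with ω hω
  refine propext (hω.trans ?_)
  change _ ↔ ω ∈ ⋃ n, eventMap Ψ (S n)
  simp only [mem_iUnion, eventMap_eq (hS _)]
  rfl

theorem eventMap_inter {S T : Set Ω} (hS : MeasurableSet[⨆ i, ℱ i] S)
    (hT : MeasurableSet[⨆ i, ℱ i] T) :
    eventMap Ψ (S ∩ T) =ᵐ[μ'] (eventMap Ψ S ∩ eventMap Ψ T : Set Ω') := by
  have h := eventMap_ae_eq (Ψ := Ψ) (hS.inter hT)
    (fun n => if n = 0 then indicatorL0 μ (iSup_filtration_le ℱ) S hS else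
      indicatorL0 μ (iSup_filtration_le ℱ) T hT) (B := {x | x 0 = 1} ∩ {x | x 1 = 1})
    ((measurableSet_apply_eq_one 0).inter
      (measurableSet_apply_eq_one 1)) (by
      filter_upwards [indicatorL0_mem_iff (μ := μ) hS, indicatorL0_mem_iff (μ := μ) hT]
        with ω h₁ h₂
      simp only [mem_inter_iff, mem_ofPred_eq, if_true, one_ne_zero, if_false, h₁, h₂])
  filter_upwards [h] with ω hω
  refine propext (hω.trans ?_)
  change _ ↔ ω ∈ eventMap Ψ S ∩ eventMap Ψ T
  simp only [mem_inter_iff, mem_ofPred_eq, if_true, one_ne_zero, if_false, eventMap_eq hS,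
    eventMap_eq hT]

theorem measurableSet_eventMap_filtration {i : ι} {S : Set Ω} (hS : MeasurableSet[ℱ i] S) :
    MeasurableSet[ℱ' i] (eventMap Ψ S) := by
  have hS' : MeasurableSet[⨆ i, ℱ i] S := le_iSup (fun i => ℱ i) i S hS
  let X : L0 (⨆ i, ℱ i) μ := indicatorL0 μ (iSup_filtration_le ℱ) S hS'
  have hX : X.1 ∈ L0 (ℱ i) μ := aestronglyMeasurable_indicatorClass (ℱ.le i) hS
  rw [eventMap_eq hS', ← Ψ.generate i]
  have hle : (⨆ X : L0 (⨆ i, ℱ i) μ, ⨆ (_ : X.1 ∈ L0 (ℱ i) μ),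
      MeasurableSpace.comap ((Ψ.toEquiv X).1 : Ω' → ℝ) (borel ℝ)) ≤ m0' := by
    refine iSup₂_le fun X _ => ?_
    rw [← BorelSpace.measurable_eq (α := ℝ)]
    exact (AEEqFun.measurable _).comap_le
  refine le_completion hle _ (le_iSup₂ (f := fun (X : L0 (⨆ i, ℱ i) μ)
    (_ : X.1 ∈ L0 (ℱ i) μ) => MeasurableSpace.comap ((Ψ.toEquiv X).1 : Ω' → ℝ) (borel ℝ))
    X hX _ ⟨{1}, ?_, rfl⟩)
  rw [← BorelSpace.measurable_eq (α := ℝ)]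
  exact measurableSet_singleton _

/-- The events almost equal to an image form a σ-field. It contains the generators of `ℱ' i`, since
commutation with Borel functions identifies the event that the image of a variable lies in `B` with
the image of the event that the variable does. -/
theorem exists_eventMap_ae_eq {i : ι} {S' : Set Ω'} (hS' : MeasurableSet[ℱ' i] S') :
    ∃ S, MeasurableSet[ℱ i] S ∧ eventMap Ψ S =ᵐ[μ'] S' := by
  have hle : ℱ i ≤ ⨆ i, ℱ i := le_iSup (fun i => ℱ i) i
  let 𝓜 : MeasurableSpace Ω' :=
    { MeasurableSet' := fun S' => ∃ S, MeasurableSet[ℱ i] S ∧ eventMap Ψ S =ᵐ[μ'] S'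
      measurableSet_empty := by
        refine ⟨∅, @MeasurableSet.empty _ (ℱ i), ?_⟩
        rw [ae_eq_empty, measure_eventMap (@MeasurableSet.empty _ (⨆ i, ℱ i)), measure_empty]
      measurableSet_compl := by
        rintro S' ⟨S, hS, h⟩
        exact ⟨Sᶜ, hS.compl, (eventMap_compl (hle _ hS)).trans h.compl⟩
      measurableSet_iUnion := by
        intro S' h
        choose S hS h using h
        exact ⟨⋃ n, S n, .iUnion hS, (eventMap_iUnion fun n => hle _ (hS n)).trans
          (Filter.EventuallyEq.countable_iUnion h)⟩ }
  rw [← Ψ.generate i] at hS'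
  obtain ⟨⟨T', hT', hST⟩, -⟩ := measurableSet_completion_iff.1 hS'
  have h𝓜 : (⨆ X : L0 (⨆ i, ℱ i) μ, ⨆ (_ : X.1 ∈ L0 (ℱ i) μ),
      MeasurableSpace.comap ((Ψ.toEquiv X).1 : Ω' → ℝ) (borel ℝ)) ≤ 𝓜 := by
    refine iSup₂_le fun X hX => ?_
    rw [← BorelSpace.measurable_eq (α := ℝ)]
    rintro _ ⟨B, hB, rfl⟩
    obtain ⟨f, hf, hXf⟩ : AEStronglyMeasurable[ℱ i] X.1 μ := hX
    have hS : MeasurableSet[ℱ i] (f ⁻¹' B) := hf.measurable hB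
    refine ⟨f ⁻¹' B, hS, ?_⟩
    have h := eventMap_ae_eq (Ψ := Ψ) (hle _ hS) (fun _ => X) (B := {x | x 0 ∈ B})
      (measurable_pi_apply 0 hB) (by
        filter_upwards [hXf] with ω hω
        simp only [mem_preimage, hω])
    filter_upwards [h] with ω hω
    exact propext hω
  obtain ⟨S, hS, h⟩ := h𝓜 _ hT'
  exact ⟨S, hS, h.trans hST.symm⟩

end Transport

/-- Hypothesis `h` says that the conditional probability of `s` given `m` is `c` on `H` and `0`
elsewhere. Conditional independence carries the resulting formula to events outside `m`. This is how
immersion is used: the larger past gives no better prediction. -/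
theorem measure_inter_of_condExp_inter {Ω : Type*} {m : MeasurableSpace Ω}
    {m0 : MeasurableSpace Ω} {μ : Measure Ω} [IsProbabilityMeasure μ] (hm : m ≤ m0)
    {s T H : Set Ω} {c : ℝ≥0}
    (hs : MeasurableSet s) (hT : MeasurableSet T) (hH : MeasurableSet[m] H)
    (h : ∀ T, MeasurableSet[m] T → μ (s ∩ T) = c * μ (T ∩ H))
    (hsT : μ⟦s ∩ T | m⟧ =ᵐ[μ] μ⟦s | m⟧ * μ⟦T | m⟧) : μ (s ∩ T) = c * μ (T ∩ H) := by
  have hs1 : (H.indicator fun _ => (c : ℝ)) =ᵐ[μ] μ⟦s | m⟧ := by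
    refine ae_eq_condExp_of_forall_setIntegral_eq hm ((integrable_const _).indicator hs)
      (fun t _ _ => ((integrable_const _).indicator (hm H hH)).integrableOn) (fun t ht _ => ?_)
      ((@stronglyMeasurable_const _ _ m _ _).indicator hH).aestronglyMeasurable
    rw [setIntegral_indicator (hm H hH), setIntegral_indicator hs, setIntegral_const,
      setIntegral_const, inter_comm t s]
    simp only [Measure.real, h t ht, ENNReal.toReal_mul, ENNReal.coe_toReal, smul_eq_mul, mul_one]
    rw [mul_comm]
  have hint : ∫ ω, (μ⟦s ∩ T | m⟧) ω ∂μ = μ.real (s ∩ T) := by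
    rw [integral_condExp hm, integral_indicator_const _ (hs.inter hT)]
    simp
  have hint2 : ∫ ω, (μ⟦s | m⟧ * μ⟦T | m⟧) ω ∂μ = c * μ.real (T ∩ H) := by
    have : (μ⟦s | m⟧ * μ⟦T | m⟧) =ᵐ[μ] H.indicator fun ω => (c : ℝ) * (μ⟦T | m⟧) ω := by
      filter_upwards [hs1] with ω hω
      rw [Pi.mul_apply, ← hω]
      by_cases hωH : ω ∈ H <;> simp [hωH]
    rw [integral_congr_ae this, integral_indicator (hm H hH), integral_const_mul,
      setIntegral_condExp hm ((integrable_const _).indicator hT) hH, setIntegral_indicator hT,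
      setIntegral_const, inter_comm H T]
    simp
  have hreal : μ.real (s ∩ T) = c * μ.real (T ∩ H) := by
    rw [← hint, ← hint2, integral_congr_ae hsT]
  rw [← ENNReal.toReal_eq_toReal_iff' (measure_ne_top _ _)
    (ENNReal.mul_ne_top ENNReal.coe_ne_top (measure_ne_top _ _)), ENNReal.toReal_mul,
    ENNReal.coe_toReal]
  exact hreal

/-! ### Images of discrete variables and a criterion of non-standardness -/

section Transport

variable {Ω Ω' ι : Type*} {m0 : MeasurableSpace Ω} {m0' : MeasurableSpace Ω'} [Preorder ι]
  {μ : Measure Ω} {μ' : Measure Ω'} {ℱ : Filtration ι m0} {ℱ' : Filtration ι m0'}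
  {Ψ : FiltrationIso μ μ' ℱ ℱ'}

theorem eventMap_empty : eventMap Ψ ∅ =ᵐ[μ'] (∅ : Set Ω') := by
  rw [ae_eq_empty, measure_eventMap (@MeasurableSet.empty _ (⨆ i, ℱ i)), measure_empty]

theorem eventMap_iUnion_of_countable {E : Type*} [Countable E] {S : E → Set Ω}
    (hS : ∀ e, MeasurableSet[⨆ i, ℱ i] (S e)) :
    eventMap Ψ (⋃ e, S e) =ᵐ[μ'] ⋃ e, eventMap Ψ (S e) := by
  cases isEmpty_or_nonempty E
  · simpa using eventMap_empty
  · obtain ⟨f, hf⟩ := exists_surjective_nat E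
    rw [← hf.iUnion_comp, ← hf.iUnion_comp (fun e => eventMap Ψ (S e))]
    exact eventMap_iUnion fun n => hS (f n)

theorem preimage_eq_iUnion_fibre {E : Type*} (Y : Ω → E) (C : Set E) :
    Y ⁻¹' C = ⋃ e : C, Y ⁻¹' {(e : E)} := by
  ext ω; simp

theorem eventMap_preimage_ae_eq {E : Type*} [Countable E] [MeasurableSpace E]
    [DiscreteMeasurableSpace E] {Y : Ω → E} (hY : Measurable[⨆ i, ℱ i] Y) {y : Ω' → E}
    (h : ∀ e, y ⁻¹' {e} =ᵐ[μ'] eventMap Ψ (Y ⁻¹' {e})) (C : Set E) :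
    y ⁻¹' C =ᵐ[μ'] eventMap Ψ (Y ⁻¹' C) := by
  rw [preimage_eq_iUnion_fibre, preimage_eq_iUnion_fibre]
  exact (Filter.EventuallyEq.countable_iUnion fun e : C => h e).trans
    (eventMap_iUnion_of_countable fun e : C => hY (measurableSet_singleton _)).symm

theorem eventMap_preimage_prodMk {E₁ E₂ : Type*} [Countable E₁] [Countable E₂]
    [MeasurableSpace E₁] [MeasurableSpace E₂]
    [DiscreteMeasurableSpace E₁] [DiscreteMeasurableSpace E₂] {Y₁ : Ω → E₁} {Y₂ : Ω → E₂}
    (hY₁ : Measurable[⨆ i, ℱ i] Y₁) (hY₂ : Measurable[⨆ i, ℱ i] Y₂) {y₁ : Ω' → E₁} {y₂ : Ω' → E₂}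
    (h₁ : ∀ C, y₁ ⁻¹' C =ᵐ[μ'] eventMap Ψ (Y₁ ⁻¹' C))
    (h₂ : ∀ C, y₂ ⁻¹' C =ᵐ[μ'] eventMap Ψ (Y₂ ⁻¹' C)) (C : Set (E₁ × E₂)) :
    (fun ω => (y₁ ω, y₂ ω)) ⁻¹' C =ᵐ[μ'] eventMap Ψ ((fun ω => (Y₁ ω, Y₂ ω)) ⁻¹' C) := by
  refine eventMap_preimage_ae_eq (hY₁.prodMk hY₂) (fun e => ?_) C
  rw [← singleton_prod_singleton (a := e.1) (b := e.2), mk_preimage_prod, mk_preimage_prod]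
  exact ((h₁ _).inter (h₂ _)).trans (eventMap_inter (hY₁ (measurableSet_singleton _))
    (hY₂ (measurableSet_singleton _))).symm

theorem ae_existsUnique_mem_eventMap {E : Type*} [Countable E] [MeasurableSpace E]
    [DiscreteMeasurableSpace E] {Y : Ω → E} (hY : Measurable[⨆ i, ℱ i] Y) :
    ∀ᵐ ω ∂μ', ∃! e, ω ∈ eventMap Ψ (Y ⁻¹' {e}) := by
  have hYe e : MeasurableSet[⨆ i, ℱ i] (Y ⁻¹' {e}) := hY (measurableSet_singleton _)
  have h₁ : ∀ᵐ ω ∂μ', ω ∈ ⋃ e, eventMap Ψ (Y ⁻¹' {e}) := by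
    have h : (univ : Set Ω') =ᵐ[μ'] ⋃ e, eventMap Ψ (Y ⁻¹' {e}) := by
      have h := (eventMap_compl (Ψ := Ψ) (@MeasurableSet.empty _ (⨆ i, ℱ i))).trans
        (eventMap_empty (Ψ := Ψ)).compl
      rw [compl_empty, compl_empty] at h
      have h' := eventMap_iUnion_of_countable (Ψ := Ψ) hYe
      rw [show ⋃ e, Y ⁻¹' {e} = univ by ext; simp] at h'
      exact h.symm.trans h'
    filter_upwards [h] with ω hω
    exact hω.mp trivial
  have h₂ : ∀ᵐ ω ∂μ', ∀ e e', e ≠ e' →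
      ¬ (ω ∈ eventMap Ψ (Y ⁻¹' {e}) ∧ ω ∈ eventMap Ψ (Y ⁻¹' {e'})) := by
    simp only [ae_all_iff]
    intro e e' hne
    have h := (eventMap_inter (Ψ := Ψ) (hYe e) (hYe e')).symm
    have h0 : Y ⁻¹' {e} ∩ Y ⁻¹' {e'} = ∅ := by
      ext ω
      simp only [mem_inter_iff, mem_preimage, mem_singleton_iff, mem_empty_iff_false, iff_false]
      rintro ⟨rfl, h'⟩
      exact hne h'
    rw [h0] at h
    filter_upwards [h.trans eventMap_empty] with ω hω hmem
    exact hω.mp hmem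
  filter_upwards [h₁, h₂] with ω h₁ h₂
  obtain ⟨e, he⟩ := mem_iUnion.1 h₁
  refine ⟨e, he, fun e' he' => ?_⟩
  by_contra hne
  exact h₂ e' e hne ⟨he', he⟩

/-- If `ℱ'` is included in the natural filtration of `V`, the image of a discrete variable is a
function of `V`. -/
theorem exists_cylinderEvents_representation {V : ι → Ω' → ℝ}
    (hle : ∀ i, ℱ' i ≤ naturalFiltration μ' V i) {E : Type*} [Countable E] [Nonempty E]
    [MeasurableSpace E] [DiscreteMeasurableSpace E] {i : ι} {Y : Ω → E} (hY : Measurable[ℱ i] Y) :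
    ∃ y : (ι → ℝ) → E, Measurable[cylinderEvents (Iic i)] y ∧
      ∀ C, (fun ω => y fun j => V j ω) ⁻¹' C =ᵐ[μ'] eventMap Ψ (Y ⁻¹' C) := by
  have hYsup : Measurable[⨆ i, ℱ i] Y := hY.mono (le_iSup (fun i => ℱ i) i) le_rfl
  -- Up to a null set, the image of each fibre is a cylinder event in `V`. These events form only an
  -- almost partition, which `exists_measurable_of_partition` turns into a genuine function.
  have hT (e : E) : ∃ T : Set (ι → ℝ), MeasurableSet[cylinderEvents (Iic i)] T ∧
      eventMap Ψ (Y ⁻¹' {e}) =ᵐ[μ'] (fun ω j => V j ω) ⁻¹' T := by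
    have h : MeasurableSet[naturalFiltration μ' V i] (eventMap Ψ (Y ⁻¹' {e})) :=
      hle i _ (measurableSet_eventMap_filtration (hY (measurableSet_singleton e)))
    obtain ⟨⟨u, hu, heu⟩, -⟩ := measurableSet_completion_iff.1 h
    have : (⨆ j, ⨆ (_ : j ≤ i), MeasurableSpace.comap (V j) inferInstance) ≤
        MeasurableSpace.comap (fun ω j => V j ω) (cylinderEvents (Iic i)) := by
      refine iSup₂_le fun j hj => ?_
      rw [← measurable_iff_comap_le]
      exact (measurable_cylinderEvent_apply (mem_Iic.2 hj)).comp
        (comap_measurable (m := cylinderEvents (X := fun _ : ι => ℝ) (Iic i)) _)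
    obtain ⟨T, hT, rfl⟩ := this _ hu
    exact ⟨T, hT, heu⟩
  choose T hTm hT using hT
  obtain ⟨y, hy, hyT⟩ := exists_measurable_of_partition T hTm
  refine ⟨y, hy, eventMap_preimage_ae_eq hYsup fun e => ?_⟩
  filter_upwards [ae_existsUnique_mem_eventMap (Ψ := Ψ) hYsup, ae_all_iff.2 hT] with ω hω hωT
  have hiff e : ω ∈ eventMap Ψ (Y ⁻¹' {e}) ↔ (fun j => V j ω) ∈ T e := iff_of_eq (hωT e)
  simp only [hiff] at hω
  exact propext ((hyT _ hω e).trans (hiff e).symm)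

end Transport

/-- A filtration is not standard if it carries a process `A` whose states are revealed in two
stages, in such a way that two copies of `A` which differ are unlikely to meet afterwards. -/
theorem not_isStandard_of_two_stages {Ω ι : Type*} {m0 : MeasurableSpace Ω} [LinearOrder ι]
    {μ : Measure Ω} [IsProbabilityMeasure μ] {ℱ : Filtration ι m0} {t s : ℕ → ι}
    (hts : ∀ k, t k ⋖ s k) (hst : ∀ k, s (k + 1) ≤ t k) (hcof : ∀ i, ∀ᶠ N in atTop, ¬ i ≤ t N)
    {X Y : ℕ → Type*} [∀ k, Fintype (X k)] [∀ k, Countable (Y k)]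
    [∀ k, MeasurableSpace (X k)] [∀ k, MeasurableSpace (Y k)]
    [∀ k, DiscreteMeasurableSpace (X k)] [∀ k, DiscreteMeasurableSpace (Y k)]
    {A : ∀ k, Ω → X k} {B : ∀ k, Ω → Y k} {g : ∀ k, X (k + 1) → X k → Y k}
    {c : ℕ → ℝ≥0} {ε δ : ℕ → ℝ≥0∞}
    (hA : ∀ k, Measurable[ℱ (s k)] (A k)) (hB : ∀ k, Measurable[ℱ (t k)] (B k))
    (hg : ∀ k ω, B k ω = g k (A (k + 1) ω) (A k ω))
    (hlaw : ∀ k x S, MeasurableSet[ℱ (t k)] S →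
      μ (A k ⁻¹' {x} ∩ S) = c k * μ (S ∩ {ω | g k (A (k + 1) ω) x = B k ω}))
    (hg' : ∀ k x x' y y', x ≠ x' →
      c k * ({z | g k x z = y ∧ g k x' z = y'}.ncard : ℝ≥0∞) ≤ ε k)
    (hδ : ∀ k x, μ (A k ⁻¹' {x}) ≤ δ k)
    {r : ℝ≥0∞} (hr : r < 1) (hεδ : ∀ N, δ (N + 1) + ∑ k ∈ Finset.range (N + 1), ε k ≤ r) :
    ¬ IsStandard μ ℱ := by
  rintro ⟨Ω', m0', μ', ℱ', 𝒢', _, ⟨Ψ⟩, ⟨hle, hci⟩, V, hV, hVi, rfl⟩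
  have : Nonempty Ω := nonempty_of_isProbabilityMeasure μ
  have : ∀ k, Nonempty (X k) := fun k => ⟨A k (Classical.arbitrary Ω)⟩
  have : ∀ k, Nonempty (Y k) := fun k => ⟨B k (Classical.arbitrary Ω)⟩
  have : ∀ i, IsProbabilityMeasure (μ'.map (V i)) := fun i =>
    Measure.isProbabilityMeasure_map (hV i).aemeasurable
  let v : Ω' → ι → ℝ := fun ω i => V i ω
  have hv : Measurable v := measurable_pi_iff.2 hV
  have hP : Measure.infinitePi (fun i => μ'.map (V i)) = μ'.map v :=
    (hVi.map_fun_eq_infinitePi_map hV).symm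
  choose α hα hαA using fun k => exists_cylinderEvents_representation (Ψ := Ψ) hle (hA k)
  choose β hβ hβB using fun k => exists_cylinderEvents_representation (Ψ := Ψ) hle (hB k)
  have hsup i : ℱ i ≤ ⨆ i, ℱ i := le_iSup (fun i => ℱ i) i
  have hAs k : Measurable[⨆ i, ℱ i] (A k) := (hA k).mono (hsup _) le_rfl
  have hBs k : Measurable[⨆ i, ℱ i] (B k) := (hB k).mono (hsup _) le_rfl
  have hαm k : Measurable (α k) := (hα k).mono cylinderEvents_le_pi le_rfl
  have hβm k : Measurable (β k) := (hβ k).mono cylinderEvents_le_pi le_rfl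
  have hAt k : Measurable[ℱ (t k)] (A (k + 1)) := (hA (k + 1)).mono (ℱ.mono (hst k)) le_rfl
  have hH k x : MeasurableSet[ℱ (t k)] {ω | g k (A (k + 1) ω) x = B k ω} :=
    ((hAt k).prodMk (hB k)) (MeasurableSet.of_discrete
      (s := {q : X (k + 1) × Y k | g k q.1 x = q.2}))
  -- Immersion enters here: the conditional law of `A k`, known given `ℱ (t k)`, persists given the
  -- whole past of `V`.
  have hlaw' k x (T : Set Ω') (hT : MeasurableSet[naturalFiltration μ' V (t k)] T) :
      μ' (eventMap Ψ (A k ⁻¹' {x}) ∩ T) =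
        c k * μ' (T ∩ eventMap Ψ {ω | g k (A (k + 1) ω) x = B k ω}) := by
    refine measure_inter_of_condExp_inter (ℱ'.le (t k)) (measurableSet_eventMap _)
      ((naturalFiltration μ' V).le _ _ hT) (measurableSet_eventMap_filtration (hH k x))
      (fun T' hT' => ?_) (hci _ _ (hts k) _ _
        (measurableSet_eventMap_filtration (hA k (measurableSet_singleton x))) hT)
    obtain ⟨S, hS, hST⟩ := exists_eventMap_ae_eq (Ψ := Ψ) hT'
    have h₁ := (eventMap_inter (Ψ := Ψ) (hAs k (measurableSet_singleton x)) (hsup _ _ hS)).trans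
      ((ae_eq_refl _).inter hST)
    have h₂ := (eventMap_inter (Ψ := Ψ) (hsup _ _ hS) (hsup _ _ (hH k x))).trans
      (hST.inter (ae_eq_refl _))
    rw [← measure_congr h₁, ← measure_congr h₂,
      measure_eventMap (@MeasurableSet.inter _ (⨆ i, ℱ i) _ _
        (hAs k (measurableSet_singleton x)) (hsup _ _ hS)),
      measure_eventMap (@MeasurableSet.inter _ (⨆ i, ℱ i) _ _ (hsup _ _ hS) (hsup _ _ (hH k x))),
      hlaw k x S hS]
  have hpair k := eventMap_preimage_prodMk (Ψ := Ψ) (hAs (k + 1)) (hBs k) (hαA (k + 1)) (hβB k)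
  have htriple k := eventMap_preimage_prodMk (Ψ := Ψ) ((hAs (k + 1)).prodMk (hBs k)) (hAs k)
    (hpair k) (hαA k)
  refine false_of_innovations (fun i => μ'.map (V i)) hcof (α := α) (β := β) (g := g)
    (c := fun k => c k) (ε := ε) (δ := δ)
    (fun k => (hα (k + 1)).mono (cylinderEvents_mono (Iic_subset_Iic.2 (hst k))) le_rfl)
    hαm hβ (fun k => ?_) (fun k x S hS => ?_) hg' (fun k x => ?_) hr hεδ
  · have hm : MeasurableSet {w | β k w = g k (α (k + 1) w) (α k w)} :=
      (((hαm (k + 1)).prodMk (hβm k)).prodMk (hαm k)) (MeasurableSet.of_discrete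
        (s := {q : (X (k + 1) × Y k) × X k | q.1.2 = g k q.1.1 q.2}))
    rw [hP, ae_map_iff hv.aemeasurable hm]
    have h := htriple k {q | q.1.2 ≠ g k q.1.1 q.2}
    have h0 : (fun ω => ((A (k + 1) ω, B k ω), A k ω)) ⁻¹' {q | q.1.2 ≠ g k q.1.1 q.2} = ∅ := by
      ext ω
      simp [hg k ω]
    rw [h0] at h
    filter_upwards [h.trans eventMap_empty] with ω hω
    by_contra hne
    exact hω.mp hne
  · have hSm := cylinderEvents_le_pi _ hS
    have hvS : MeasurableSet[naturalFiltration μ' V (t k)] (v ⁻¹' S) := by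
      have : Measurable[⨆ j, ⨆ (_ : j ≤ t k), MeasurableSpace.comap (V j) inferInstance,
          cylinderEvents (Iic (t k))] v := by
        rw [measurable_cylinderEvents_iff]
        intro j hj
        exact measurable_iff_comap_le.2 (le_iSup₂ (f := fun j (_ : j ≤ t k) =>
          MeasurableSpace.comap (V j) inferInstance) j hj)
      exact le_completion (iSup₂_le fun j _ => (hV j).comap_le) _ (this hS)
    have hm : MeasurableSet {w | g k (α (k + 1) w) x = β k w} :=
      ((hαm (k + 1)).prodMk (hβm k)) (MeasurableSet.of_discrete
        (s := {q : X (k + 1) × Y k | g k q.1 x = q.2}))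
    rw [hP, show {w | α k w = x} = α k ⁻¹' {x} from rfl,
      Measure.map_apply hv ((hαm k (measurableSet_singleton x)).inter hSm),
      Measure.map_apply hv (hSm.inter hm)]
    refine (measure_congr ((hαA k {x}).inter (ae_eq_refl (v ⁻¹' S)))).trans
      ((hlaw' k x _ hvS).trans ?_)
    congr 1
    exact measure_congr ((ae_eq_refl (v ⁻¹' S)).inter
      (hpair k {q | g k q.1 x = q.2}).symm)
  · rw [hP]
    refine (Measure.map_apply hv (hαm k (measurableSet_singleton x))).trans_le ?_
    refine (measure_congr (hαA k {x})).trans_le ?_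
    rw [measure_eventMap (hAs k (measurableSet_singleton x))]
    exact hδ k x

/-! ### A polynomial code and the alphabets -/

section Code

open Polynomial in
/-- Polynomials without constant term of degree at most `4` provide many functions which pairwise
agree, up to a constant, at few points. -/
theorem exists_code {F X : Type*} [Field F] [Finite F] [Finite X]
    (h : Nat.card X ≤ Nat.card F ^ 4) :
    ∃ ψ : X → F → F, ∀ x x' c, x ≠ x' → {z | ψ x z - ψ x' z = c}.ncard ≤ 4 := by
  classical
  have := Fintype.ofFinite F
  have := Fintype.ofFinite X
  obtain ⟨e⟩ : Nonempty (X ↪ (Fin 4 → F)) := Function.Embedding.nonempty_of_card_le (by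
    rw [Nat.card_eq_fintype_card, Nat.card_eq_fintype_card] at h
    simpa using h)
  -- Only the degrees 1 to 4 occur, so the difference of two distinct polynomials of the family is
  -- not constant, and subtracting `c` leaves a nonzero polynomial with at most four roots.
  let p : X → F[X] := fun x => ∑ i : Fin 4, monomial (i + 1 : ℕ) (e x i)
  refine ⟨fun x z => (p x).eval z, fun x x' c hne => ?_⟩
  let q : F[X] := p x - p x' - C c
  have hcoeff (y : X) (i : Fin 4) : (p y).coeff (i + 1) = e y i := by
    simp only [p, finsetSum_coeff, coeff_monomial]
    rw [Finset.sum_eq_single i (fun j _ hj => if_neg (by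
      intro h; apply hj; ext; omega)) (by simp)]
    simp
  have hdeg (y : X) : (p y).natDegree ≤ 4 := natDegree_sum_le_of_forall_le _ _ fun i _ =>
    (natDegree_monomial_le _).trans (by omega)
  have hq : q ≠ 0 := by
    intro h0
    apply hne
    apply e.injective
    funext i
    have := congrArg (fun r => r.coeff (i + 1)) h0
    simpa [q, hcoeff, coeff_C, sub_eq_zero] using this
  have hqdeg : q.natDegree ≤ 4 := by
    refine (natDegree_sub_le _ _).trans (max_le ((natDegree_sub_le _ _).trans
      (max_le (hdeg x) (hdeg x'))) ?_)
    simp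
  have hsub : {z | (p x).eval z - (p x').eval z = c} ⊆ (q.roots.toFinset : Set F) := by
    intro z hz
    rw [Finset.mem_coe, Multiset.mem_toFinset, mem_roots hq, IsRoot.def]
    simp only [q, eval_sub, eval_C]
    rw [show (p x).eval z - (p x').eval z = c from hz, sub_self]
  calc _ ≤ (q.roots.toFinset : Set F).ncard := Set.ncard_le_ncard hsub
    _ = q.roots.toFinset.card := Set.ncard_coe_finset _
    _ ≤ q.roots.card := Multiset.toFinset_card_le _
    _ ≤ 4 := (card_roots' q).trans hqdeg

/-- The field with `2 ^ (k + 4)` elements. -/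
def Alphabet (k : ℕ) : Type := GaloisField 2 (k + 4)

noncomputable instance (k : ℕ) : Field (Alphabet k) := inferInstanceAs (Field (GaloisField 2 _))

instance (k : ℕ) : Finite (Alphabet k) := inferInstanceAs (Finite (GaloisField 2 _))

noncomputable instance (k : ℕ) : Fintype (Alphabet k) := Fintype.ofFinite _

instance (k : ℕ) : MeasurableSpace (Alphabet k) := ⊤

instance (k : ℕ) : DiscreteMeasurableSpace (Alphabet k) := ⟨fun _ => trivial⟩

theorem card_alphabet (k : ℕ) : Nat.card (Alphabet k) = 2 ^ (k + 4) :=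
  GaloisField.card 2 (k + 4) (by omega)

theorem card_alphabet_prod_le (k : ℕ) :
    Nat.card (Alphabet (k + 1) × Alphabet (k + 1)) ≤ Nat.card (Alphabet k) ^ 4 := by
  rw [Nat.card_prod, card_alphabet, card_alphabet, ← pow_add, ← pow_mul]
  exact Nat.pow_le_pow_right (by norm_num) (by omega)

/-- A large family of functions which pairwise agree, up to a constant, at few points. -/
noncomputable def code (k : ℕ) : Alphabet (k + 1) × Alphabet (k + 1) → Alphabet k → Alphabet k :=
  (exists_code (card_alphabet_prod_le k)).choose

theorem ncard_code_sub_eq_le (k : ℕ) (x x' : Alphabet (k + 1) × Alphabet (k + 1)) (c : Alphabet k)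
    (h : x ≠ x') : {z | code k x z - code k x' z = c}.ncard ≤ 4 :=
  (exists_code (card_alphabet_prod_le k)).choose_spec x x' c h

end Code

/-! ### Criteria of independence -/

section Independence

/-- A family of σ-fields is independent if each of them is independent of a σ-field which contains
the following ones. -/
theorem iIndep_of_indep_of_lt {Ω ι α : Type*} [LinearOrder α] {m0 : MeasurableSpace Ω}
    {μ : Measure Ω} [IsProbabilityMeasure μ] {m 𝓗 : ι → MeasurableSpace Ω} {ρ : ι → α}
    (hρ : Function.Injective ρ) (h : ∀ i, Indep (m i) (𝓗 i) μ)
    (hm : ∀ i j, ρ i < ρ j → m j ≤ 𝓗 i) : iIndep m μ := by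
  classical
  rw [iIndep_iff]
  intro s
  -- Once the index of least `ρ` is removed, all the remaining events lie in its `𝓗 i`.
  induction s using Finset.induction_on_min_value ρ with
  | empty => simp
  | insert i s his hmin ih =>
    intro f hf
    rw [Finset.set_biInter_insert, Finset.prod_insert his,
      ← ih fun j hj => hf j (Finset.mem_insert_of_mem hj)]
    refine (Indep_iff _ _ _).1 (h i) _ _ (hf i (Finset.mem_insert_self _ _)) ?_
    refine MeasurableSet.biInter (m := 𝓗 i) s.countable_toSet fun j hj => ?_
    refine hm i j (lt_of_le_of_ne (hmin j hj) fun he => his ?_) _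
      (hf j (Finset.mem_insert_of_mem hj))
    rwa [hρ he]

theorem indep_comap_of_forall_singleton {Ω E : Type*} {m m0 : MeasurableSpace Ω}
    {μ : Measure Ω} [Finite E] [MeasurableSpace E] [DiscreteMeasurableSpace E] (hm : m ≤ m0)
    {U : Ω → E} (hU : Measurable U)
    (h : ∀ e s, MeasurableSet[m] s → μ (U ⁻¹' {e} ∩ s) = μ (U ⁻¹' {e}) * μ s) :
    Indep (MeasurableSpace.comap U inferInstance) m μ := by
  classical
  have := Fintype.ofFinite E
  rw [Indep_iff]
  rintro _ s ⟨C, -, rfl⟩ hs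
  have hC : U ⁻¹' C = ⋃ e ∈ (Finset.univ.filter (· ∈ C)), U ⁻¹' {e} := by ext ω; simp
  have hd : (↑(Finset.univ.filter (· ∈ C)) : Set E).PairwiseDisjoint fun e => U ⁻¹' {e} :=
    fun e _ e' _ hne => Disjoint.preimage _ (disjoint_singleton.2 hne)
  have hme e : MeasurableSet (U ⁻¹' {e}) := hU (measurableSet_singleton e)
  rw [hC, iUnion₂_inter, measure_biUnion_finset hd fun e _ => hme e,
    measure_biUnion_finset (hd.mono fun e => inter_subset_left)
      fun e _ => (hme e).inter (hm _ hs), Finset.sum_mul]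
  exact Finset.sum_congr rfl fun e _ => h e s hs

/-- On each event where the `m`-measurable offset `H` is constant, the shift only permutes values of
equal conditional weight. -/
theorem measure_sub_inter_eq {Ω G : Type*} {m m0 : MeasurableSpace Ω} {μ : Measure Ω}
    [AddGroup G] [Fintype G] [MeasurableSpace G] [DiscreteMeasurableSpace G] (hm : m ≤ m0)
    {W H : Ω → G} {r : ℝ≥0∞} (hW : Measurable W)
    (h : ∀ e s, MeasurableSet[m] s → μ (W ⁻¹' {e} ∩ s) = r * μ s) (hH : Measurable[m] H)
    (e : G) {s : Set Ω} (hs : MeasurableSet[m] s) :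
    μ ((fun ω => W ω - H ω) ⁻¹' {e} ∩ s) = r * μ s := by
  have hHs d : MeasurableSet[m] (H ⁻¹' {d} ∩ s) :=
    (hH (measurableSet_singleton d)).inter hs
  have hd : (↑(Finset.univ : Finset G) : Set G).PairwiseDisjoint fun d => H ⁻¹' {d} ∩ s :=
    fun e _ e' _ hne => (Disjoint.preimage _ (disjoint_singleton.2 hne)).mono
      inter_subset_left inter_subset_left
  have h₁ : (fun ω => W ω - H ω) ⁻¹' {e} ∩ s =
      ⋃ d ∈ (Finset.univ : Finset G), W ⁻¹' {e + d} ∩ (H ⁻¹' {d} ∩ s) := by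
    ext ω; simp [sub_eq_iff_eq_add]
  have h₂ : s = ⋃ d ∈ (Finset.univ : Finset G), H ⁻¹' {d} ∩ s := by ext ω; simp
  rw [h₁, measure_biUnion_finset (hd.mono fun d => inter_subset_right)
    fun d _ => (hW (measurableSet_singleton _)).inter (hm _ (hHs d))]
  conv_rhs => rw [h₂, measure_biUnion_finset hd fun d _ => hm _ (hHs d), Finset.mul_sum]
  exact Finset.sum_congr rfl fun d _ => h _ _ (hHs d)

end Independence

/-! ### Independent letters and innovations -/

section Source

/-- The space of sequences of pairs of letters. -/
abbrev Source : Type := ∀ p : ℕ × Bool, Alphabet p.1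

/-- The law of independent uniform letters. -/
noncomputable def sourceMeasure : Measure Source :=
  Measure.infinitePi fun p : ℕ × Bool => uniformOn (univ : Set (Alphabet p.1))

instance (k : ℕ) : IsProbabilityMeasure (uniformOn (univ : Set (Alphabet k))) :=
  isProbabilityMeasure_uniformOn finite_univ univ_nonempty

instance : IsProbabilityMeasure sourceMeasure := by
  unfold sourceMeasure; infer_instance

theorem measure_source_apply (p : ℕ × Bool) (e : Alphabet p.1) :
    sourceMeasure ((fun ω => ω p) ⁻¹' {e}) = (Nat.card (Alphabet p.1) : ℝ≥0∞)⁻¹ := by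
  rw [← Measure.map_apply (measurable_pi_apply p) (measurableSet_singleton e), sourceMeasure,
    Measure.infinitePi_map_eval, uniformOn_univ, Measure.count_singleton,
    Nat.card_eq_fintype_card, one_div]

theorem indep_cylinderEvents {S T : Set (ℕ × Bool)} (h : Disjoint S T) :
    Indep (cylinderEvents (X := fun p : ℕ × Bool => Alphabet p.1) S) (cylinderEvents T)
      sourceMeasure :=
  indep_iSup_of_disjoint (fun p => (measurable_pi_apply p).comap_le)
    (iIndepFun_infinitePi (P := fun p : ℕ × Bool => uniformOn (univ : Set (Alphabet p.1)))
      (X := fun _ x => x) fun _ => measurable_id).iIndep h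

theorem measure_source_inter {p : ℕ × Bool} {S : Set (ℕ × Bool)} (hp : p ∉ S) (e : Alphabet p.1)
    {s : Set Source} (hs : MeasurableSet[cylinderEvents S] s) :
    sourceMeasure ((fun ω => ω p) ⁻¹' {e} ∩ s) =
      (Nat.card (Alphabet p.1) : ℝ≥0∞)⁻¹ * sourceMeasure s := by
  rw [← measure_source_apply p e]
  refine (Indep_iff _ _ _).1 (indep_cylinderEvents (disjoint_singleton_left.2 hp)) _ _ ?_ hs
  exact measurable_cylinderEvent_apply (mem_singleton p) (measurableSet_singleton e)

/-- The pair of letters of rank `k`. -/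
def pairAt (k : ℕ) (ω : Source) : Alphabet k × Alphabet k := (ω (k, true), ω (k, false))

/-- What is revealed of the pair of letters of rank `k` at the first stage. -/
noncomputable def firstStage (k : ℕ) (ω : Source) : Alphabet k :=
  ω (k, false) - code k (pairAt (k + 1) ω) (ω (k, true))

/-- The innovations, when the letters whose rank is in `G` are not revealed in two stages. -/
noncomputable def innovation (G : Set ℕ) : ∀ p : ℕ × Bool, Source → Alphabet p.1
  | (k, true), ω => ω (k, true)
  | (k, false), ω => by
      classical exact if k ∈ G then ω (k, false) else firstStage k ω

theorem innovation_of_mem {G : Set ℕ} {k : ℕ} (h : k ∈ G) (ω : Source) :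
    innovation G (k, false) ω = ω (k, false) := by
  simp [innovation, h]

theorem innovation_of_notMem {G : Set ℕ} {k : ℕ} (h : k ∉ G) (ω : Source) :
    innovation G (k, false) ω = firstStage k ω := by
  simp [innovation, h]

theorem measurable_pairAt {m : MeasurableSpace Source} {k : ℕ}
    (h₁ : Measurable[m] fun ω : Source => ω (k, true))
    (h₂ : Measurable[m] fun ω : Source => ω (k, false)) : Measurable[m] (pairAt k) :=
  h₁.prodMk h₂

theorem measurable_code {m : MeasurableSpace Source} {k : ℕ}
    (h₁ : Measurable[m] (pairAt (k + 1))) (h₂ : Measurable[m] fun ω : Source => ω (k, true)) :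
    Measurable[m] fun ω : Source => code k (pairAt (k + 1) ω) (ω (k, true)) :=
  (Measurable.of_discrete (f := fun q : (Alphabet (k + 1) × Alphabet (k + 1)) × Alphabet k =>
    code k q.1 q.2)).comp (h₁.prodMk h₂)

theorem measurable_firstStage {m : MeasurableSpace Source} {k : ℕ}
    (h₁ : Measurable[m] (pairAt (k + 1))) (h₂ : Measurable[m] (pairAt k)) :
    Measurable[m] (firstStage k) :=
  (Measurable.of_discrete (f := fun q : (Alphabet (k + 1) × Alphabet (k + 1)) ×
    (Alphabet k × Alphabet k) => q.2.2 - code k q.1 q.2.1)).comp (h₁.prodMk h₂)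

theorem measurable_pairAt_cylinderEvents {S : Set (ℕ × Bool)} {k : ℕ} (h : ∀ b, (k, b) ∈ S) :
    Measurable[cylinderEvents S] (pairAt k) :=
  measurable_pairAt (measurable_cylinderEvent_apply (h true))
    (measurable_cylinderEvent_apply (h false))

theorem measurable_innovation (G : Set ℕ) (p : ℕ × Bool) :
    Measurable[cylinderEvents {q | p.1 ≤ q.1}] (innovation G p) := by
  obtain ⟨k, _ | _⟩ := p
  · by_cases h : k ∈ G
    · simp only [funext (innovation_of_mem h)]
      exact measurable_cylinderEvent_apply (le_refl k)
    · simp only [funext (innovation_of_notMem h)]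
      exact measurable_firstStage (measurable_pairAt_cylinderEvents fun _ => Nat.le_succ k)
        (measurable_pairAt_cylinderEvents fun _ => le_refl k)
  · exact measurable_cylinderEvent_apply (le_refl k)

/-- The letters on which the offset of the innovation `p` may depend. -/
def laterLetters (p : ℕ × Bool) : Set (ℕ × Bool) := {q | p.1 < q.1 ∨ (p.1 = q.1 ∧ p.2 < q.2)}

/-- The innovation is the letter `p` minus an offset, possibly zero, which is a function of
`laterLetters p`; the letter is uniform and independent of those. -/
theorem measure_innovation_inter (G : Set ℕ) (p : ℕ × Bool) (e : Alphabet p.1) {s : Set Source}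
    (hs : MeasurableSet[cylinderEvents (laterLetters p)] s) :
    sourceMeasure (innovation G p ⁻¹' {e} ∩ s) =
      (Nat.card (Alphabet p.1) : ℝ≥0∞)⁻¹ * sourceMeasure s := by
  have hp : p ∉ laterLetters p := by simp [laterLetters]
  obtain ⟨k, _ | _⟩ := p
  · by_cases h : k ∈ G
    · simp only [funext (innovation_of_mem h)]
      exact measure_source_inter hp e hs
    · simp only [funext (innovation_of_notMem h)]
      refine measure_sub_inter_eq cylinderEvents_le_pi (measurable_pi_apply (k, false))
        (fun e s hs => measure_source_inter hp e hs) (measurable_code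
        (measurable_pairAt_cylinderEvents fun b => Or.inl (Nat.lt_succ_self k))
        (measurable_cylinderEvent_apply (Or.inr ⟨rfl, ?_⟩))) e hs
      exact Bool.false_lt_true
  · exact measure_source_inter hp e hs

theorem measure_innovation (G : Set ℕ) (p : ℕ × Bool) (e : Alphabet p.1) :
    sourceMeasure (innovation G p ⁻¹' {e}) = (Nat.card (Alphabet p.1) : ℝ≥0∞)⁻¹ := by
  simpa using measure_innovation_inter G p e MeasurableSet.univ

/-- For any `G`, the change from letters to innovations is triangular in the lexicographic order,
with `false` before `true`: innovations which follow `p` depend only on `laterLetters p`. -/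
theorem iIndepFun_innovation (G : Set ℕ) : iIndepFun (innovation G) sourceMeasure := by
  refine iIndep_of_indep_of_lt (ρ := fun p : ℕ × Bool => toLex p) toLex.injective
    (𝓗 := fun p => cylinderEvents (laterLetters p)) (fun p => ?_) fun p q hpq => ?_
  · refine indep_comap_of_forall_singleton cylinderEvents_le_pi
      ((measurable_innovation G p).mono cylinderEvents_le_pi le_rfl) fun e s hs => ?_
    rw [measure_innovation_inter G p e hs, measure_innovation]
  · rw [← measurable_iff_comap_le]
    rcases Prod.Lex.toLex_lt_toLex.1 hpq with h | ⟨h, h'⟩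
    · exact (measurable_innovation G q).mono
        (cylinderEvents_mono fun r hr => Or.inl (h.trans_le hr)) le_rfl
    · obtain ⟨k, _ | _⟩ := q
      · exact absurd h' (by simp)
      · exact measurable_cylinderEvent_apply (Or.inr ⟨h, h'⟩)

end Source

/-! ### The process and the σ-fields of its past -/

section TwoStageProcess

/-- The values of the process when the letters of rank `k` are concerned. -/
abbrev State (k : ℕ) : Type :=
  (Alphabet (k + 1) × Alphabet (k + 1)) × (Alphabet k × Alphabet k)

open Classical in
/-- The state of the process at time `-m`. -/
noncomputable def state (m : ℕ) (ω : Source) : State (m / 2) :=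
  -- One type serves both parities; the zeros only fill the unused components.
  if Even m then (0, pairAt (m / 2) ω) else (pairAt (m / 2 + 1) ω, (firstStage (m / 2) ω, 0))

/-- The σ-field generated by the process up to time `-m`. -/
@[reducible] noncomputable def past (m : ℕ) : MeasurableSpace Source :=
  ⨆ j, ⨆ (_ : m ≤ j), MeasurableSpace.comap (state j) inferInstance

/-- The time, up to sign, at which the innovation `p` is revealed. -/
def revealTime (p : ℕ × Bool) : ℕ := 2 * p.1 + (if p.2 then 0 else 1)

theorem revealTime_true (k : ℕ) : revealTime (k, true) = 2 * k := rfl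

theorem revealTime_false (k : ℕ) : revealTime (k, false) = 2 * k + 1 := rfl

/-- The σ-field generated by the innovations up to time `-m`. -/
@[reducible] noncomputable def innovationPast (G : Set ℕ) (m : ℕ) : MeasurableSpace Source :=
  ⨆ p, ⨆ (_ : m ≤ revealTime p), MeasurableSpace.comap (innovation G p) inferInstance

theorem state_of_even {m : ℕ} (h : Even m) : state m = fun ω => (0, pairAt (m / 2) ω) :=
  funext fun _ => if_pos h

theorem state_of_not_even {m : ℕ} (h : ¬ Even m) :
    state m = fun ω => (pairAt (m / 2 + 1) ω, (firstStage (m / 2) ω, 0)) :=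
  funext fun _ => if_neg h

theorem measurable_state {𝓗 : MeasurableSpace Source} {m : ℕ}
    (h₁ : Even m → Measurable[𝓗] (pairAt (m / 2)))
    (h₂ : ¬ Even m → Measurable[𝓗] (pairAt (m / 2 + 1)))
    (h₃ : ¬ Even m → Measurable[𝓗] (firstStage (m / 2))) : Measurable[𝓗] (state m) := by
  by_cases h : Even m
  · rw [state_of_even h]
    exact measurable_const.prodMk (h₁ h)
  · rw [state_of_not_even h]
    exact (h₂ h).prodMk ((h₃ h).prodMk measurable_const)

theorem measurable_state_past {m j : ℕ} (h : m ≤ j) : Measurable[past m] (state j) :=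
  measurable_iff_comap_le.2 (le_iSup₂ (f := fun j (_ : m ≤ j) =>
    MeasurableSpace.comap (state j) inferInstance) j h)

theorem measurable_innovation_innovationPast {G : Set ℕ} {m : ℕ} {p : ℕ × Bool}
    (h : m ≤ revealTime p) : Measurable[innovationPast G m] (innovation G p) :=
  measurable_iff_comap_le.2 (le_iSup₂ (f := fun p (_ : m ≤ revealTime p) =>
    MeasurableSpace.comap (innovation G p) inferInstance) p h)

theorem measurable_pairAt_of_state {𝓗 : MeasurableSpace Source} {m k : ℕ} (hk : m = 2 * k)
    (h : Measurable[𝓗] (state m)) : Measurable[𝓗] (pairAt k) := by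
  obtain rfl : k = m / 2 := by omega
  rw [state_of_even (by rw [hk]; simp)] at h
  exact measurable_snd.comp h

theorem measurable_of_state_odd {𝓗 : MeasurableSpace Source} {m k : ℕ} (hk : m = 2 * k + 1)
    (h : Measurable[𝓗] (state m)) :
    Measurable[𝓗] (pairAt (k + 1)) ∧ Measurable[𝓗] (firstStage k) := by
  obtain rfl : k = m / 2 := by omega
  rw [state_of_not_even (by rw [hk]; simp)] at h
  exact ⟨measurable_fst.comp h, measurable_fst.comp (measurable_snd.comp h)⟩

theorem measurable_pairAt_past {m k : ℕ} (h : m ≤ 2 * k) : Measurable[past m] (pairAt k) :=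
  measurable_pairAt_of_state rfl (measurable_state_past h)

theorem measurable_firstStage_past {m k : ℕ} (h : m ≤ 2 * k + 1) :
    Measurable[past m] (firstStage k) :=
  (measurable_of_state_odd rfl (measurable_state_past h)).2

theorem measurable_source_apply {𝓗 : MeasurableSpace Source} {k : ℕ}
    (h : Measurable[𝓗] (pairAt k)) (b : Bool) : Measurable[𝓗] fun ω : Source => ω (k, b) := by
  cases b
  · exact measurable_snd.comp h
  · exact measurable_fst.comp h

theorem past_antitone : Antitone past := fun _ _ h =>
  iSup₂_mono' fun j hj => ⟨j, h.trans hj, le_rfl⟩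

theorem past_le (m : ℕ) : past m ≤ MeasurableSpace.pi := by
  have hp k : Measurable (pairAt k) :=
    measurable_pairAt (measurable_pi_apply _) (measurable_pi_apply _)
  exact iSup₂_le fun j _ => (measurable_state (fun _ => hp _) (fun _ => hp _)
    (fun _ => measurable_firstStage (hp _) (hp _))).comap_le

/-- The process and the innovations generate the same σ-fields, if the innovations start again
infinitely often. -/
theorem past_eq_innovationPast {G : Set ℕ} (hG : ∀ k, ∃ j, k ≤ j ∧ j ∈ G) {m : ℕ}
    (hm : ∀ k, m = 2 * k + 1 → k ∉ G) : past m = innovationPast G m := by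
  refine le_antisymm (iSup₂_le fun j hj => measurable_iff_comap_le.1 ?_)
    (iSup₂_le fun p hp => measurable_iff_comap_le.1 ?_)
  -- Induction on the distance to a rank of `G`. At a rank of `G` both letters are innovations;
  -- elsewhere the pair of rank `k + 1` is already known, and adding the code value to the hint
  -- restores the second letter.
  · have hp : ∀ n k, m ≤ 2 * k → k + n ∈ G → Measurable[innovationPast G m] (pairAt k) := by
      intro n
      induction n with
      | zero =>
        intro k hk hkG
        rw [add_zero] at hkG
        have h := measurable_innovation_innovationPast (G := G) (p := (k, false))
          (hk.trans (Nat.le_succ _))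
        rw [funext (innovation_of_mem hkG)] at h
        exact measurable_pairAt (measurable_innovation_innovationPast (p := (k, true)) hk) h
      | succ n ih =>
        intro k hk hkG
        have h₁ := measurable_innovation_innovationPast (G := G) (p := (k, true)) hk
        have h := measurable_innovation_innovationPast (G := G) (p := (k, false))
          (hk.trans (Nat.le_succ _))
        by_cases hkG' : k ∈ G
        · rw [funext (innovation_of_mem hkG')] at h
          exact measurable_pairAt h₁ h
        · rw [funext (innovation_of_notMem hkG')] at h
          refine measurable_pairAt h₁ ?_
          have h₂ := measurable_code (k := k) (ih (k + 1) (by omega)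
            (by rwa [add_assoc, add_comm 1 n])) h₁
          have h₃ := (Measurable.of_discrete (f := fun q : Alphabet k × Alphabet k =>
            q.1 + q.2)).comp (h.prodMk h₂)
          refine (congrArg _ (funext fun ω => ?_)).mp h₃
          simp [firstStage]
    have hp' {k : ℕ} (hk : m ≤ 2 * k) : Measurable[innovationPast G m] (pairAt k) := by
      obtain ⟨i, hi, hiG⟩ := hG k
      exact hp (i - k) k hk (by rwa [Nat.add_sub_cancel' hi])
    refine measurable_state (fun h => hp' ?_) (fun h => hp' ?_) fun h => ?_
    · rw [Nat.even_iff] at h; omega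
    · rw [Nat.not_even_iff] at h; omega
    · rw [Nat.not_even_iff] at h
      rcases Nat.lt_or_ge (2 * (j / 2)) m with hlt | hge
      -- Here `m = j` is odd, and the pair of rank `j / 2` is not known yet; `hm` ensures that the
      -- hint itself is an innovation.
      · have hjG : j / 2 ∉ G := hm _ (by omega)
        have := measurable_innovation_innovationPast (G := G) (m := m) (p := (j / 2, false))
          (by rw [revealTime_false]; omega)
        rwa [funext (innovation_of_notMem hjG)] at this
      · exact measurable_firstStage (hp' (by omega)) (hp' hge)
  · obtain ⟨k, _ | _⟩ := p
    · rw [revealTime_false] at hp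
      by_cases hkG : k ∈ G
      · rw [funext (innovation_of_mem hkG)]
        have : m ≠ 2 * k + 1 := fun h => hm k h hkG
        exact measurable_source_apply (measurable_pairAt_past (by omega)) false
      · rw [funext (innovation_of_notMem hkG)]
        exact measurable_firstStage_past hp
    · exact measurable_source_apply (measurable_pairAt_past hp) true

/-- The innovation of the process at time `-m`. -/
noncomputable def stageInnovation (m : ℕ) : Source → Alphabet (m / 2) :=
  innovation ∅ (m / 2, decide (Even m))

theorem stageInnovation_of_even {m : ℕ} (h : Even m) :
    stageInnovation m = fun ω => ω (m / 2, true) := by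
  unfold stageInnovation
  rw [decide_eq_true h]
  rfl

theorem stageInnovation_of_not_even {m : ℕ} (h : ¬ Even m) :
    stageInnovation m = firstStage (m / 2) := by
  unfold stageInnovation
  rw [decide_eq_false h]
  exact funext (innovation_of_notMem (notMem_empty _))

theorem measure_stageInnovation (m : ℕ) (e : Alphabet (m / 2)) :
    sourceMeasure (stageInnovation m ⁻¹' {e}) = (Nat.card (Alphabet (m / 2)) : ℝ≥0∞)⁻¹ :=
  measure_innovation ∅ (m / 2, decide (Even m)) e

theorem measurable_stageInnovation_past {m n : ℕ} (h : n ≤ m) :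
    Measurable[past n] (stageInnovation m) := by
  by_cases hm : Even m
  · rw [stageInnovation_of_even hm]
    refine measurable_source_apply (measurable_pairAt_past ?_) true
    rw [Nat.even_iff] at hm; omega
  · rw [stageInnovation_of_not_even hm]
    refine measurable_firstStage_past ?_
    rw [Nat.not_even_iff] at hm; omega

theorem measurable_stageInnovation (m : ℕ) : Measurable (stageInnovation m) :=
  (measurable_stageInnovation_past le_rfl).mono (past_le m) le_rfl

/-- Taking `G` to be all ranks beyond `m / 2` makes the past before time `-m` a σ-field of
innovations while leaving the present one unchanged; independence of the innovations then concludes.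
-/
theorem indep_stageInnovation_past (m : ℕ) :
    Indep (MeasurableSpace.comap (stageInnovation m) inferInstance) (past (m + 1))
      sourceMeasure := by
  have hpast : past (m + 1) = innovationPast (Ioi (m / 2)) (m + 1) := by
    refine past_eq_innovationPast (fun k => ⟨max k (m / 2 + 1), le_max_left _ _, ?_⟩) fun k hk => ?_
    · exact lt_of_lt_of_le (Nat.lt_succ_self _) (le_max_right _ _)
    · simp only [mem_Ioi, not_lt]; omega
  have hinn : stageInnovation m = innovation (Ioi (m / 2)) (m / 2, decide (Even m)) := by
    by_cases hm : Even m
    · rw [stageInnovation_of_even hm, decide_eq_true hm]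
      rfl
    · rw [stageInnovation_of_not_even hm, decide_eq_false hm]
      exact (funext (innovation_of_notMem (lt_irrefl (m / 2)))).symm
  have htime : revealTime (m / 2, decide (Even m)) < m + 1 := by
    by_cases hm : Even m
    · rw [decide_eq_true hm, revealTime_true]; omega
    · rw [decide_eq_false hm, revealTime_false]
      rw [Nat.not_even_iff] at hm; omega
  have h := indep_iSup_of_disjoint
    (fun p => ((measurable_innovation (Ioi (m / 2)) p).mono cylinderEvents_le_pi le_rfl).comap_le)
    (iIndepFun_innovation (Ioi (m / 2))).iIndep
    (S := {(m / 2, decide (Even m))}) (T := {p | m + 1 ≤ revealTime p})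
    (disjoint_singleton_left.2 (not_le.2 htime))
  rw [hpast, hinn]
  rw [iSup_singleton] at h
  exact h

/-- At an even time the preceding pair, the hint and the new first letter determine the second
letter. At an odd time the innovation is the hint, and the preceding pair is the preceding state. -/
theorem state_eq_of_stageInnovation_eq {m : ℕ} {ω ω' : Source}
    (h : state (m + 1) ω = state (m + 1) ω') (h' : stageInnovation m ω = stageInnovation m ω') :
    state m ω = state m ω' := by
  by_cases hm : Even m
  · have hm' : ¬ Even (m + 1) := by simpa [Nat.even_add_one] using hm
    have h2 : (m + 1) / 2 = m / 2 := by rw [Nat.even_iff] at hm; omega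
    rw [stageInnovation_of_even hm] at h'
    have hs : ∀ j, (m + 1) / 2 = j → pairAt (j + 1) ω = pairAt (j + 1) ω' ∧
        firstStage j ω = firstStage j ω' := by
      rintro _ rfl
      rw [state_of_not_even hm'] at h
      simp only [Prod.mk.injEq, and_true] at h
      exact h
    obtain ⟨h₁, h₂⟩ := hs _ h2
    rw [state_of_even hm]
    simp only [Prod.mk.injEq, true_and]
    refine Prod.ext h' ?_
    simp only at h'
    simp only [firstStage, h₁, h'] at h₂
    exact sub_left_injective h₂
  · have hm' : Even (m + 1) := by simpa [Nat.even_add_one] using hm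
    have h2 : (m + 1) / 2 = m / 2 + 1 := by rw [Nat.not_even_iff] at hm; omega
    rw [stageInnovation_of_not_even hm] at h'
    have hs : ∀ j, (m + 1) / 2 = j → pairAt j ω = pairAt j ω' := by
      rintro _ rfl
      rw [state_of_even hm'] at h
      exact congrArg Prod.snd h
    rw [state_of_not_even hm]
    simp only [hs _ h2, h']

theorem past_eq_sup (m : ℕ) :
    past m = past (m + 1) ⊔ MeasurableSpace.comap (stageInnovation m) inferInstance := by
  refine le_antisymm (iSup₂_le fun j hj => ?_) (sup_le (past_antitone (Nat.le_succ m))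
    (measurable_stageInnovation_past le_rfl).comap_le)
  rcases hj.eq_or_lt with rfl | hj
  · rw [← measurable_iff_comap_le]
    let W : Source → State ((m + 1) / 2) × Alphabet (m / 2) :=
      fun ω => (state (m + 1) ω, stageInnovation m ω)
    have hf : Function.FactorsThrough (state m) W := fun ω ω' h =>
      state_eq_of_stageInnovation_eq (congrArg Prod.fst h) (congrArg Prod.snd h)
    rw [← hf.extend_comp fun _ => 0]
    exact Measurable.of_discrete.comp (((measurable_state_past le_rfl).mono le_sup_left le_rfl).prodMk
      (measurable_iff_comap_le.2 le_sup_right))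
  · exact le_sup_of_le_left (measurable_iff_comap_le.1 (measurable_state_past hj))

end TwoStageProcess

/-! ### Conditional laws given an independent innovation -/

section Markov

/-- The conditional law, given the past, of a variable which is determined by its predecessor and an
independent innovation. -/
theorem condExp_preimage_ae_eq {Ω E₁ E₂ E₃ : Type*} {m m0 : MeasurableSpace Ω} {μ : Measure Ω}
    [IsProbabilityMeasure μ] (hm : m ≤ m0) [MeasurableSpace E₁] [DiscreteMeasurableSpace E₁]
    [Fintype E₂] [MeasurableSpace E₂] [DiscreteMeasurableSpace E₂]
    {Y : Ω → E₁} {U : Ω → E₂} {W : Ω → E₃} (hY : Measurable[m] Y) (hU : Measurable U)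
    (hind : Indep (MeasurableSpace.comap U inferInstance) m μ) {B : Set E₃}
    (hW : W ⁻¹' B = {ω | ∃ ω', Y ω = Y ω' ∧ U ω = U ω' ∧ W ω' ∈ B}) :
    μ⟦W ⁻¹' B | m⟧ =ᵐ[μ] fun ω => ∑ u, μ.real (U ⁻¹' {u}) *
      {y | ∃ ω', y = Y ω' ∧ u = U ω' ∧ W ω' ∈ B}.indicator (fun _ => (1 : ℝ)) (Y ω) := by
  classical
  let D : E₂ → Set Ω := fun u => Y ⁻¹' {y | ∃ ω', y = Y ω' ∧ u = U ω' ∧ W ω' ∈ B}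
  have hD u : MeasurableSet[m] (D u) := hY (MeasurableSet.of_discrete)
  have hUm u : MeasurableSet (U ⁻¹' {u}) := hU (measurableSet_singleton u)
  have hWU : W ⁻¹' B = ⋃ u ∈ (Finset.univ : Finset E₂), U ⁻¹' {u} ∩ D u := by
    rw [hW]
    ext ω
    simp only [D, mem_iUnion, mem_inter_iff, mem_preimage, mem_singleton_iff, Finset.mem_univ,
      exists_true_left, mem_ofPred_eq]
    constructor
    · rintro ⟨ω', h₁, h₂, h₃⟩
      exact ⟨U ω, rfl, ω', h₁, h₂, h₃⟩
    · rintro ⟨u, rfl, ω', h₁, h₂, h₃⟩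
      exact ⟨ω', h₁, h₂, h₃⟩
  have hWm : MeasurableSet (W ⁻¹' B) := by
    rw [hWU]
    exact .biUnion (Finset.countable_toSet _) fun u _ => (hUm u).inter (hm _ (hD u))
  have hint u : Integrable ((D u).indicator fun _ => (1 : ℝ)) μ :=
    (integrable_const _).indicator (hm _ (hD u))
  change _ =ᵐ[μ] fun ω => ∑ u, μ.real (U ⁻¹' {u}) * (D u).indicator (fun _ => (1 : ℝ)) ω
  symm
  refine ae_eq_condExp_of_forall_setIntegral_eq hm ((integrable_const _).indicator hWm)
    (fun s _ _ => (integrable_finsetSum _ fun u _ => (hint u).const_mul _).integrableOn)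
    (fun s hs _ => ?_) ?_
  · rw [integral_finsetSum _ fun u _ => ((hint u).const_mul _).integrableOn,
      setIntegral_indicator hWm, setIntegral_const, smul_eq_mul, mul_one]
    have hdisj : (↑(Finset.univ : Finset E₂) : Set E₂).PairwiseDisjoint
        fun u => U ⁻¹' {u} ∩ (D u ∩ s) := fun u _ u' _ hne =>
      (Disjoint.preimage _ (disjoint_singleton.2 hne)).mono inter_subset_left inter_subset_left
    have hs' : s ∩ W ⁻¹' B = ⋃ u ∈ (Finset.univ : Finset E₂), U ⁻¹' {u} ∩ (D u ∩ s) := by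
      rw [hWU, inter_comm, iUnion₂_inter]
      simp only [inter_assoc]
    rw [hs', measureReal_biUnion_finset hdisj fun u _ => (hUm u).inter (hm _ ((hD u).inter hs))]
    refine Finset.sum_congr rfl fun u _ => ?_
    rw [integral_const_mul, setIntegral_indicator (hm _ (hD u)), setIntegral_const, smul_eq_mul,
      mul_one, inter_comm s]
    simp only [Measure.real]
    rw [(Indep_iff _ _ _).1 hind _ _ ⟨{u}, measurableSet_singleton u, rfl⟩ ((hD u).inter hs),
      ENNReal.toReal_mul]
  · refine StronglyMeasurable.aestronglyMeasurable
      (Finset.stronglyMeasurable_fun_sum _ fun u _ => StronglyMeasurable.const_mul ?_ _)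
    exact (@stronglyMeasurable_const _ _ m _ _).indicator (hD u)

/-- Both sides equal the same explicit sum, a function of `Y` in which the conditioning σ-field does
not appear. -/
theorem condExp_preimage_eq_of_innovation {Ω E₁ E₂ E₃ : Type*} {m₁ m₂ m0 : MeasurableSpace Ω}
    {μ : Measure Ω} [IsProbabilityMeasure μ] (h₁₂ : m₁ ≤ m₂) (hm : m₂ ≤ m0)
    [MeasurableSpace E₁] [DiscreteMeasurableSpace E₁]
    [Fintype E₂] [MeasurableSpace E₂] [DiscreteMeasurableSpace E₂]
    {Y : Ω → E₁} {U : Ω → E₂} {W : Ω → E₃} (hY : Measurable[m₁] Y) (hU : Measurable U)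
    (hind : Indep (MeasurableSpace.comap U inferInstance) m₂ μ)
    (hW : ∀ ω ω', Y ω = Y ω' → U ω = U ω' → W ω = W ω') (B : Set E₃) :
    μ⟦W ⁻¹' B | m₂⟧ =ᵐ[μ] μ⟦W ⁻¹' B | m₁⟧ := by
  have hWB : W ⁻¹' B = {ω | ∃ ω', Y ω = Y ω' ∧ U ω = U ω' ∧ W ω' ∈ B} := by
    ext ω
    constructor
    · exact fun h => ⟨ω, rfl, rfl, h⟩
    · rintro ⟨ω', h₁, h₂, h₃⟩
      rw [mem_preimage, hW ω ω' h₁ h₂]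
      exact h₃
  exact (condExp_preimage_ae_eq hm (hY.mono h₁₂ le_rfl) hU hind hWB).trans
    (condExp_preimage_ae_eq (h₁₂.trans hm) hY hU (indep_of_indep_of_le_right hind h₁₂) hWB).symm

end Markov

/-! ### Markov, adic and independence properties of the process -/

section TwoStageProcess

/-- The process, indexed by the nonpositive integers. -/
noncomputable def process (n : NonposInt) : Source → State (n.1.natAbs / 2) := state n.1.natAbs

theorem natAbs_prev (n : NonposInt) : n.prev.1.natAbs = n.1.natAbs + 1 := by
  have := n.2
  simp only [NonposInt.prev]
  omega

theorem naturalFiltration_process (n : NonposInt) :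
    (naturalFiltration sourceMeasure process n : MeasurableSpace Source) =
      completion sourceMeasure (past n.1.natAbs) := by
  refine congrArg (completion sourceMeasure)
    (le_antisymm (iSup₂_le fun j hj => ?_) (iSup₂_le fun j hj => ?_))
  · refine le_iSup₂_of_le j.1.natAbs ?_ le_rfl
    have h : j.1 ≤ n.1 := hj
    have := n.2
    omega
  · refine le_iSup₂_of_le (⟨-(j : ℤ), by omega⟩ : NonposInt) ?_ ?_
    · change -(j : ℤ) ≤ n.1
      omega
    · have : ∀ i, i = j → MeasurableSpace.comap (state j) inferInstance ≤
          MeasurableSpace.comap (state i) inferInstance := by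
        rintro _ rfl; exact le_rfl
      exact this _ (by simp)

theorem measurable_process (n : NonposInt) : Measurable (process n) :=
  (measurable_state_past le_rfl).mono (past_le _) le_rfl

theorem comap_process_prev_le {n : NonposInt} :
    MeasurableSpace.comap (process n.prev) inferInstance ≤
      (naturalFiltration sourceMeasure process n.prev : MeasurableSpace Source) := by
  rw [naturalFiltration_process]
  exact (measurable_iff_comap_le.1 (measurable_state_past le_rfl)).trans
    (le_completion (past_le _))

theorem indep_stageInnovation_prev (n : NonposInt) :
    Indep (MeasurableSpace.comap (stageInnovation n.1.natAbs) inferInstance)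
      (naturalFiltration sourceMeasure process n.prev) sourceMeasure := by
  rw [naturalFiltration_process, natAbs_prev]
  exact indep_completion_right (indep_stageInnovation_past _)

theorem isMarkov_process : IsMarkov sourceMeasure process := by
  intro n B _
  refine condExp_preimage_eq_of_innovation comap_process_prev_le
    ((naturalFiltration sourceMeasure process).le _) (comap_measurable _)
    (measurable_stageInnovation n.1.natAbs) (indep_stageInnovation_prev n) (fun ω ω' h h' => ?_) B
  have : ∀ i, i = n.1.natAbs + 1 → state i ω = state i ω' →
      state (n.1.natAbs + 1) ω = state (n.1.natAbs + 1) ω' := by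
    rintro _ rfl h; exact h
  exact state_eq_of_stageInnovation_eq (this _ (natAbs_prev n) h) h'

theorem isAdicFiltration_process : IsAdicFiltration sourceMeasure
    (naturalFiltration sourceMeasure process) fun n => Nat.card (Alphabet (n.1.natAbs / 2)) := by
  intro n
  let e := Finite.equivFin (Alphabet (n.1.natAbs / 2))
  have hcomap : MeasurableSpace.comap (e ∘ stageInnovation n.1.natAbs) inferInstance =
      MeasurableSpace.comap (stageInnovation n.1.natAbs) inferInstance := by
    rw [← MeasurableSpace.comap_comp]
    refine congrArg _ (le_antisymm (fun _ _ => trivial) fun s _ => ⟨e '' s, trivial, ?_⟩)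
    exact e.injective.preimage_image s
  refine ⟨Nat.card_pos, e ∘ stageInnovation n.1.natAbs,
    (Measurable.of_discrete).comp (measurable_stageInnovation _), fun i => ?_, ?_, ?_⟩
  · rw [preimage_comp, ← measure_stageInnovation n.1.natAbs (e.symm i)]
    congr 2
    ext x
    simp [Equiv.eq_symm_apply]
  · rw [hcomap]
    exact indep_stageInnovation_prev n
  · rw [hcomap, naturalFiltration_process, naturalFiltration_process, natAbs_prev,
      completion_sup (past_le _) (measurable_stageInnovation _).comap_le, ← past_eq_sup]

theorem iIndepFun_process_even : iIndepFun (fun n : NonposInt => process n.even)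
    sourceMeasure := by
  have hn (n : NonposInt) : n.even.1.natAbs = 2 * n.1.natAbs := by
    simp only [NonposInt.even]; omega
  have hle (n : NonposInt) : MeasurableSpace.comap (process n.even) inferInstance ≤
      cylinderEvents {p : ℕ × Bool | p.1 = n.1.natAbs} := by
    rw [← measurable_iff_comap_le]
    have he : Even n.even.1.natAbs := by rw [hn]; simp
    exact measurable_state (fun _ => measurable_pairAt_cylinderEvents fun b => by
      rw [hn]; exact Nat.mul_div_cancel_left _ two_pos) (fun h => absurd he h)
      (fun h => absurd he h)
  refine iIndep_of_indep_of_lt (ρ := fun n : NonposInt => n.1.natAbs)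
    (fun a b (h : a.1.natAbs = b.1.natAbs) => ?_)
    (𝓗 := fun n => cylinderEvents {p : ℕ × Bool | n.1.natAbs < p.1}) (fun n => ?_)
    fun a b h => (hle b).trans (cylinderEvents_mono fun p (hp : p.1 = _) => ?_)
  · have := a.2
    have := b.2
    exact Subtype.ext (by omega)
  · refine indep_of_indep_of_le_left (indep_cylinderEvents ?_) (hle n)
    exact disjoint_left.2 fun p (h : p.1 = _) (h' : _ < p.1) => by omega
  · rw [mem_ofPred_eq, hp]
    exact h

theorem exists_process_odd_eq (n : NonposInt) :
    ∃ g : State (n.evenPrev.1.natAbs / 2) × State (n.even.1.natAbs / 2) →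
        State (n.odd.1.natAbs / 2),
      ∀ ω, process n.odd ω = g (process n.evenPrev ω, process n.even ω) := by
  have h0 := n.2
  have h₁ : n.evenPrev.1.natAbs = 2 * (n.1.natAbs + 1) := by
    simp only [NonposInt.evenPrev]; omega
  have h₂ : n.even.1.natAbs = 2 * n.1.natAbs := by
    simp only [NonposInt.even]; omega
  have h₃ : n.odd.1.natAbs = 2 * n.1.natAbs + 1 := by
    simp only [NonposInt.odd]; omega
  have hpair : ∀ i k ω ω', i = 2 * k → state i ω = state i ω' → pairAt k ω = pairAt k ω' := by
    intro i k ω ω' hik h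
    obtain rfl : k = i / 2 := by omega
    rw [state_of_even (by rw [hik]; simp)] at h
    exact congrArg Prod.snd h
  have hf : Function.FactorsThrough (process n.odd)
      fun ω => (process n.evenPrev ω, process n.even ω) := by
    intro ω ω' h
    have hp₁ := hpair _ _ ω ω' h₁ (congrArg Prod.fst h)
    have hp₂ := hpair _ _ ω ω' h₂ (congrArg Prod.snd h)
    have hstate : ∀ i, i = 2 * n.1.natAbs + 1 → state i ω = state i ω' := by
      intro i hi
      rw [state_of_not_even (by rw [hi]; simp), show i / 2 = n.1.natAbs by omega]
      simp only [pairAt, Prod.mk.injEq] at hp₁ hp₂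
      simp only [firstStage, pairAt, hp₁, hp₂]
    exact hstate _ h₃
  exact ⟨_, fun ω => (congrFun (hf.extend_comp fun _ => 0) ω).symm⟩

end TwoStageProcess

/-! ### Filtrations of product type are standard -/

section ProductType

variable {ι : Type*} [Preorder ι]

theorem condIndepGiven_of_le {Ω : Type*} {m m₁ m0 : MeasurableSpace Ω} {μ : Measure Ω}
    [IsProbabilityMeasure μ] (hm : m ≤ m0) (hm₁ : m₁ ≤ m0) : CondIndepGiven μ m m₁ m := by
  intro s t hs ht
  have hint : Integrable (s.indicator fun _ => (1 : ℝ)) μ :=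
    (integrable_const _).indicator (hm₁ s hs)
  have h₁ : (s ∩ t).indicator (fun _ => (1 : ℝ)) = t.indicator (s.indicator fun _ => 1) := by
    rw [indicator_indicator, inter_comm]
  have h₂ : μ⟦t | m⟧ = t.indicator fun _ => (1 : ℝ) :=
    condExp_of_stronglyMeasurable hm ((@stronglyMeasurable_const _ _ m _ _).indicator ht)
      ((integrable_const _).indicator (hm t ht))
  rw [h₁, h₂]
  filter_upwards [condExp_indicator hint ht] with ω hω
  rw [hω, Pi.mul_apply]
  by_cases h : ω ∈ t <;> simp [h]

/-- The identity, as an isomorphism of a complete filtration onto itself. -/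
noncomputable def FiltrationIso.refl {Ω : Type*} {m0 : MeasurableSpace Ω} (μ : Measure Ω)
    (ℱ : Filtration ι m0) (hℱ : ∀ i, completion μ (ℱ i) = ℱ i) : FiltrationIso μ μ ℱ ℱ where
  toEquiv := Equiv.refl _
  map_law _ := rfl
  comm_borel _ _ _ _ h := h
  generate i := by
    have hX : ∀ X : L0 (⨆ i, ℱ i) μ, MeasurableSpace.comap (X.1 : Ω → ℝ) (borel ℝ) ≤ m0 := by
      intro X
      rw [← BorelSpace.measurable_eq (α := ℝ)]
      exact (AEEqFun.measurable _).comap_le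
    refine le_antisymm ?_ fun S hS => ?_
    · rw [← hℱ i]
      conv_rhs => rw [← completion_completion]
      refine completion_mono (iSup₂_le fun X hXi => ?_)
      rintro S hS
      have hS0 := hX X S hS
      obtain ⟨B, hB, rfl⟩ := hS
      rw [← BorelSpace.measurable_eq (α := ℝ)] at hB
      obtain ⟨f, hf, hXf⟩ : AEStronglyMeasurable[completion μ (ℱ i)] X.1 μ := hXi
      rw [hℱ i] at hf
      refine measurableSet_completion_iff.2 ⟨⟨f ⁻¹' B, hf.measurable hB, ?_⟩, hS0⟩
      filter_upwards [hXf] with ω hω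
      refine propext ?_
      change X.1 ω ∈ B ↔ f ω ∈ B
      rw [hω]
    · have hS' : MeasurableSet[⨆ i, ℱ i] S := le_iSup (fun i => ℱ i) i S hS
      let X : L0 (⨆ i, ℱ i) μ := indicatorL0 μ (iSup_filtration_le ℱ) S hS'
      have hXi : X.1 ∈ L0 (ℱ i) μ := aestronglyMeasurable_indicatorClass (ℱ.le i) hS
      refine measurableSet_completion_iff.2 ⟨⟨(X.1 : Ω → ℝ) ⁻¹' {1}, ?_, ?_⟩, ℱ.le i S hS⟩
      · refine le_iSup₂ (f := fun (X : L0 (⨆ i, ℱ i) μ) (_ : X.1 ∈ L0 (ℱ i) μ) =>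
          MeasurableSpace.comap (X.1 : Ω → ℝ) (borel ℝ)) X hXi _ ⟨{1}, ?_, rfl⟩
        rw [← BorelSpace.measurable_eq (α := ℝ)]
        exact measurableSet_singleton _
      · filter_upwards [indicatorL0_mem_iff (μ := μ) hS'] with ω hω
        exact propext hω.symm

/-- Such a filtration is complete, hence isomorphic to itself by the identity, and it is immersed in
itself. -/
theorem IsProductType.isStandard {Ω : Type} {m0 : MeasurableSpace Ω} {μ : Measure Ω}
    [IsProbabilityMeasure μ] {ℱ : Filtration ι m0} (h : IsProductType μ ℱ) : IsStandard μ ℱ := by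
  refine ⟨Ω, m0, μ, ℱ, ℱ, inferInstance, ⟨FiltrationIso.refl μ ℱ fun i => ?_⟩,
    ⟨fun _ => le_rfl, fun k n _ => condIndepGiven_of_le (ℱ.le k) (ℱ.le n)⟩, h⟩
  obtain ⟨V, -, -, rfl⟩ := h
  exact completion_completion

end ProductType

/-! ### Standardness of the extracted filtrations -/

section Extraction

theorem natAbs_le_natAbs_iff {a b : NonposInt} : a.1.natAbs ≤ b.1.natAbs ↔ b ≤ a := by
  have := a.2
  have := b.2
  change _ ↔ b.1 ≤ a.1
  omega

theorem natAbs_lt_natAbs_iff {a b : NonposInt} : a.1.natAbs < b.1.natAbs ↔ b < a := by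
  rw [← not_le, natAbs_le_natAbs_iff, not_le]

/-- The ranks of the odd times which are missed by `φ`. -/
def skippedRanks {ι : Type*} (φ : ι → NonposInt) : Set ℕ :=
  {k | ∀ i, (φ i).1.natAbs ≠ 2 * k + 1}

theorem natAbs_mem_skippedRanks_iff {ι : Type*} {φ : ι → NonposInt} {n : NonposInt} :
    n.1.natAbs ∈ skippedRanks φ ↔ n.odd ∉ range φ := by
  have := n.2
  have h i : (φ i).1.natAbs = 2 * n.1.natAbs + 1 ↔ φ i = n.odd := by
    have := (φ i).2
    rw [Subtype.ext_iff]
    simp only [NonposInt.odd]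
    omega
  simp only [skippedRanks, mem_ofPred_eq, ne_eq, h, mem_range, not_exists]

theorem infinite_skipped_iff {ι : Type*} {φ : ι → NonposInt} :
    {n : NonposInt | n.odd ∉ range φ}.Infinite ↔ ∀ k, ∃ j, k ≤ j ∧ j ∈ skippedRanks φ := by
  have hinj : Function.Injective fun n : NonposInt => n.1.natAbs := by
    intro a b (h : a.1.natAbs = b.1.natAbs)
    have := a.2
    have := b.2
    exact Subtype.ext (by omega)
  have himg : (fun n : NonposInt => n.1.natAbs) '' {n | n.odd ∉ range φ} = skippedRanks φ := by
    ext k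
    constructor
    · rintro ⟨n, hn, rfl⟩
      exact natAbs_mem_skippedRanks_iff.2 hn
    · intro hk
      have hk' : (-(k : ℤ)).natAbs = k := by simp
      refine ⟨⟨-(k : ℤ), by omega⟩, natAbs_mem_skippedRanks_iff.1 ?_, hk'⟩
      rwa [hk']
  rw [← infinite_image_iff hinj.injOn, himg]
  exact ⟨fun h k => (h.exists_gt k).imp fun j hj => ⟨hj.2.le, hj.1⟩,
    fun h => infinite_of_forall_exists_gt fun k => (h (k + 1)).imp fun j hj => ⟨hj.2, hj.1⟩⟩

variable {ι : Type*} [LinearOrder ι] {φ : ι → NonposInt}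

/-- The innovations which are revealed at the index `i` and not earlier. -/
def block (φ : ι → NonposInt) (i : ι) : Set (ℕ × Bool) :=
  {p | (φ i).1.natAbs ≤ revealTime p ∧ ∀ j < i, revealTime p < (φ j).1.natAbs}

theorem exists_mem_block (hφ : StrictMono φ) {i : ι} {p : ℕ × Bool}
    (h : (φ i).1.natAbs ≤ revealTime p) : ∃ j ≤ i, p ∈ block φ j := by
  let s : Set ℕ := {n | n ≤ revealTime p ∧ ∃ j, (φ j).1.natAbs = n}
  have hbdd : BddAbove s := ⟨revealTime p, fun n hn => hn.1⟩
  -- The largest absolute time not exceeding `revealTime p` is that of the first index at which `p`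
  -- is visible.
  obtain ⟨h₁, j, hj⟩ : sSup s ∈ s := Nat.sSup_mem ⟨_, h, i, rfl⟩ hbdd
  refine ⟨j, ?_, hj.trans_le h₁, fun j' hj' => ?_⟩
  · rw [← hφ.le_iff_le, ← natAbs_le_natAbs_iff, hj]
    exact le_csSup hbdd ⟨h, i, rfl⟩
  · by_contra hle
    have h₂ : (φ j').1.natAbs ≤ (φ j).1.natAbs := by
      rw [hj]
      exact le_csSup hbdd ⟨not_lt.1 hle, j', rfl⟩
    rw [natAbs_le_natAbs_iff, hφ.le_iff_le] at h₂
    exact absurd hj' (not_lt.2 h₂)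

/-- A real variable which carries the innovations of a block. -/
noncomputable def blockInnovation (φ : ι → NonposInt) (i : ι) (ω : Source) : ℝ :=
  embeddingReal (∀ p : block φ i, Alphabet p.1.1)
    fun p : block φ i => innovation (skippedRanks φ) p.1 ω

theorem comap_blockInnovation (i : ι) :
    MeasurableSpace.comap (blockInnovation φ i) inferInstance = ⨆ p, ⨆ (_ : p ∈ block φ i),
      MeasurableSpace.comap (innovation (skippedRanks φ) p) inferInstance := by
  have h := (measurableEmbedding_embeddingReal
    (∀ p : block φ i, Alphabet p.1.1)).comap_eq
  change MeasurableSpace.comap (embeddingReal (∀ p : block φ i, Alphabet p.1.1) ∘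
    fun ω (p : block φ i) => innovation (skippedRanks φ) p.1 ω) _ = _
  rw [← MeasurableSpace.comap_comp, h, MeasurableSpace.pi, MeasurableSpace.comap_iSup,
    iSup_subtype']
  simp only [MeasurableSpace.comap_comp]
  rfl

/-- The skipped ranks serve as `G`: they are unbounded, and no odd time in the range of `φ` has its
rank in `G`. Grouping the innovations by the index at which they first become visible gives
independent variables, coded as reals. -/
theorem isProductType_reindex_process (hφ : StrictMono φ)
    (h : {n : NonposInt | n.odd ∉ range φ}.Infinite) : IsProductType sourceMeasure
      (reindex (naturalFiltration sourceMeasure process) φ hφ.monotone) := by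
  rw [infinite_skipped_iff] at h
  have hle p : MeasurableSpace.comap (innovation (skippedRanks φ) p) inferInstance ≤
      MeasurableSpace.pi :=
    ((measurable_innovation (skippedRanks φ) p).mono cylinderEvents_le_pi le_rfl).comap_le
  refine ⟨blockInnovation φ, fun i => ?_, ?_, ?_⟩
  · rw [measurable_iff_comap_le, comap_blockInnovation]
    exact iSup₂_le fun p _ => hle p
  · refine iIndep_of_indep_of_lt (ρ := id) Function.injective_id (𝓗 := fun i =>
      ⨆ p, ⨆ (_ : p ∈ {p | revealTime p < (φ i).1.natAbs}),
        MeasurableSpace.comap (innovation (skippedRanks φ) p) inferInstance)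
      (fun i => ?_) fun i j hij => ?_
    · rw [comap_blockInnovation]
      exact indep_iSup_of_disjoint hle (iIndepFun_innovation _).iIndep
        (disjoint_left.2 fun p hp hp' => absurd hp.1 (not_le.2 hp'))
    · rw [comap_blockInnovation]
      exact biSup_mono fun p hp => hp.2 i hij
  · refine Filtration.ext (funext fun i => ?_)
    change (naturalFiltration sourceMeasure process (φ i) : MeasurableSpace Source) = _
    rw [naturalFiltration_process, past_eq_innovationPast (G := skippedRanks φ) h
      fun k hk hkG => hkG i hk]
    refine congrArg (completion sourceMeasure)
      (le_antisymm (iSup₂_le fun p hp => ?_) (iSup₂_le fun j hj => ?_))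
    · obtain ⟨j, hj, hpj⟩ := exists_mem_block hφ hp
      refine le_iSup₂_of_le j hj ?_
      rw [comap_blockInnovation]
      exact le_iSup₂_of_le p hpj le_rfl
    · rw [comap_blockInnovation]
      exact iSup₂_le fun p hp => le_iSup₂_of_le p
        ((natAbs_le_natAbs_iff.2 (hφ.monotone hj)).trans hp.1) le_rfl

theorem indep_apply_true_past (k : ℕ) :
    Indep (MeasurableSpace.comap (fun ω : Source => ω (k, true)) inferInstance)
      (past (2 * k + 1)) sourceMeasure := by
  have : ∀ m j, m = 2 * k → j = m / 2 →
      Indep (MeasurableSpace.comap (fun ω : Source => ω (j, true)) inferInstance)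
        (past (m + 1)) sourceMeasure := by
    rintro m _ hm rfl
    rw [← stageInnovation_of_even (by rw [hm]; simp)]
    exact indep_stageInnovation_past m
  exact this _ _ rfl (by omega)

/-- Given the past up to the hint, the first letter is still uniform and determines the second, so
each pair compatible with the hint has the same weight. -/
theorem measure_pairAt_inter (k : ℕ) (x : Alphabet k × Alphabet k) {S : Set Source}
    (hS : MeasurableSet[completion sourceMeasure (past (2 * k + 1))] S) :
    sourceMeasure (pairAt k ⁻¹' {x} ∩ S) = (Nat.card (Alphabet k) : ℝ≥0∞)⁻¹ *
      sourceMeasure (S ∩ {ω | x.2 - code k (pairAt (k + 1) ω) x.1 = firstStage k ω}) := by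
  have hH : MeasurableSet[past (2 * k + 1)]
      {ω | x.2 - code k (pairAt (k + 1) ω) x.1 = firstStage k ω} :=
    ((measurable_pairAt_past (k := k + 1) (by omega)).prodMk (measurable_firstStage_past le_rfl))
      (MeasurableSet.of_discrete (s := {q : (Alphabet (k + 1) × Alphabet (k + 1)) × Alphabet k |
        x.2 - code k q.1 x.1 = q.2}))
  have hset : pairAt k ⁻¹' {x} ∩ S = (fun ω : Source => ω (k, true)) ⁻¹' {x.1} ∩
      (S ∩ {ω | x.2 - code k (pairAt (k + 1) ω) x.1 = firstStage k ω}) := by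
    ext ω
    simp only [mem_inter_iff, mem_preimage, mem_singleton_iff, mem_ofPred_eq, firstStage]
    constructor
    · rintro ⟨rfl, h⟩
      exact ⟨rfl, h, rfl⟩
    · rintro ⟨h₁, h₂, h₃⟩
      rw [h₁, sub_left_inj] at h₃
      exact ⟨Prod.ext h₁ h₃.symm, h₂⟩
  rw [hset, (Indep_iff _ _ _).1 (indep_completion_right (indep_apply_true_past k)) _ _
    ⟨{x.1}, measurableSet_singleton _, rfl⟩ (hS.inter (le_completion (past_le _) _ hH)),
    measure_source_apply]

/-- Subtracting the two equations eliminates `z.2` and leaves a code equation in `z.1`, with at most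
four solutions; `z.1` then determines `z.2`. -/
theorem ncard_pairs_le (k : ℕ) (x x' : Alphabet (k + 1) × Alphabet (k + 1)) (y y' : Alphabet k)
    (h : x ≠ x') : {z : Alphabet k × Alphabet k | z.2 - code k x z.1 = y ∧
      z.2 - code k x' z.1 = y'}.ncard ≤ 4 := by
  refine le_trans ?_ (ncard_code_sub_eq_le k x x' (y' - y) h)
  refine Set.ncard_le_ncard_of_injOn Prod.fst ?_ ?_
  · rintro z ⟨rfl, rfl⟩
    simp
  · rintro z ⟨hz, -⟩ z' ⟨hz', -⟩ he
    refine Prod.ext he ?_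
    rw [sub_eq_iff_eq_add] at hz hz'
    rw [hz, hz', he]

theorem sum_inv_two_pow (n : ℕ) :
    (2⁻¹ : ℝ≥0∞) ^ (n + 1) + ∑ k ∈ Finset.range n, (2⁻¹ : ℝ≥0∞) ^ (k + 2) = 2⁻¹ := by
  induction n with
  | zero => simp
  | succ n ih =>
    rw [Finset.sum_range_succ, add_comm (∑ k ∈ Finset.range n, _), ← add_assoc]
    conv_rhs => rw [← ih]
    congr 1
    rw [← two_mul, pow_succ _ (n + 1), mul_comm, mul_assoc,
      ENNReal.inv_mul_cancel two_ne_zero ENNReal.ofNat_ne_top, mul_one]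

theorem inv_card_alphabet_le (M k : ℕ) :
    (Nat.card (Alphabet (M + k)) : ℝ≥0∞)⁻¹ * 4 ≤ 2⁻¹ ^ (k + 2) := by
  have h4 : (2⁻¹ : ℝ≥0∞) ^ 2 * 4 = 1 := by
    rw [show (4 : ℝ≥0∞) = 2 ^ 2 by norm_num, ← mul_pow,
      ENNReal.inv_mul_cancel two_ne_zero ENNReal.ofNat_ne_top, one_pow]
  rw [card_alphabet, Nat.cast_pow, Nat.cast_ofNat, ENNReal.inv_pow,
    show M + k + 4 = (M + k + 2) + 2 by ring, pow_add, mul_assoc, h4, mul_one]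
  exact pow_le_pow_right_of_le_one' (ENNReal.inv_le_one.2 one_le_two) (by omega)

theorem not_isStandard_reindex_process (hφ : StrictMono φ)
    (h : ¬ {n : NonposInt | n.odd ∉ range φ}.Infinite) : ¬ IsStandard sourceMeasure
      (reindex (naturalFiltration sourceMeasure process) φ hφ.monotone) := by
  rw [infinite_skipped_iff] at h
  push Not at h
  obtain ⟨K, hK⟩ := h
  have hrank : ∀ k, ∃ i, K ≤ k → (φ i).1.natAbs = 2 * k + 1 := by
    intro k
    by_cases hk : K ≤ k
    · have := hK k hk
      simp only [skippedRanks, mem_ofPred_eq, not_forall, not_not] at this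
      exact this.imp fun _ hi _ => hi
    · have := hK K le_rfl
      simp only [skippedRanks, mem_ofPred_eq, not_forall, not_not] at this
      exact this.imp fun _ _ h => absurd h hk
  have hlt {i j : ι} : (φ i).1.natAbs < (φ j).1.natAbs ↔ j < i := by
    rw [natAbs_lt_natAbs_iff, hφ.lt_iff_lt]
  have hle {i j : ι} : (φ i).1.natAbs ≤ (φ j).1.natAbs ↔ j ≤ i := by
    rw [natAbs_le_natAbs_iff, hφ.le_iff_le]
  choose τ hτ using hrank
  -- The shift by one ensures that the odd time of rank `M + k - 1`, which is the next one after
  -- rank `M + k`, is also in the range of `φ`.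
  let M := K + 1
  have ht (k : ℕ) : (φ (τ (M + k))).1.natAbs = 2 * (M + k) + 1 := hτ _ (by omega)
  -- The index following the odd time of rank `M + k` is the even time of that rank if it is in the
  -- range, and otherwise the next odd time. In both cases the pair of rank `M + k` has been
  -- revealed.
  have hs (k : ℕ) : ∃ i, τ (M + k) ⋖ i ∧ (φ i).1.natAbs ≤ 2 * (M + k) ∧
      2 * (M + k) - 1 ≤ (φ i).1.natAbs := by
    have hpred : (φ (τ (K + k))).1.natAbs = 2 * (K + k) + 1 := hτ _ (by omega)
    by_cases hex : ∃ i, (φ i).1.natAbs = 2 * (M + k)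
    · obtain ⟨i, hi⟩ := hex
      refine ⟨i, ⟨?_, fun j hj hj' => ?_⟩, by omega, by omega⟩
      · rw [← hlt, ht, hi]; omega
      · rw [← hlt, ht] at hj
        rw [← hlt, hi] at hj'
        omega
    · refine ⟨τ (K + k), ⟨?_, fun j hj hj' => ?_⟩, by omega, by omega⟩
      · rw [← hlt, ht, hpred]; omega
      · rw [← hlt, ht] at hj
        rw [← hlt, hpred] at hj'
        exact hex ⟨j, by omega⟩
  choose s hts hs₁ hs₂ using hs
  have hℱ i : (reindex (naturalFiltration sourceMeasure process) φ hφ.monotone i :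
      MeasurableSpace Source) = completion sourceMeasure (past (φ i).1.natAbs) :=
    naturalFiltration_process (φ i)
  refine not_isStandard_of_two_stages (t := fun k => τ (M + k)) (s := s)
    (X := fun k => Alphabet (M + k) × Alphabet (M + k)) (Y := fun k => Alphabet (M + k))
    (A := fun k => pairAt (M + k)) (B := fun k => firstStage (M + k))
    (g := fun k x z => z.2 - code (M + k) x z.1)
    (c := fun k => (Nat.card (Alphabet (M + k)) : ℝ≥0)⁻¹)
    -- With an alphabet of `2 ^ (M + k + 4)` letters, four solutions weigh at most `2⁻¹ ^ (k + 2)`;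
    -- `δ (N + 1)` completes the geometric sum to exactly one half.
    (ε := fun k => 2⁻¹ ^ (k + 2)) (δ := fun k => 2⁻¹ ^ (k + 1)) (r := 2⁻¹)
    hts (fun k => ?_) (fun i => ?_) (fun k => ?_) (fun k => ?_) (fun k ω => rfl)
    (fun k x S hS => ?_) (fun k x x' y y' hne => ?_) (fun k x => ?_)
    (ENNReal.inv_lt_one.2 ENNReal.one_lt_two) fun N => ?_
  · rw [← hle, ht]
    have := hs₂ (k + 1)
    omega
  · filter_upwards [eventually_ge_atTop (φ i).1.natAbs] with k hk
    rw [not_le, ← hlt, ht]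
    omega
  · rw [hℱ]
    exact (measurable_pairAt_past (hs₁ k)).mono (le_completion (past_le _)) le_rfl
  · rw [hℱ, ht]
    exact (measurable_firstStage_past le_rfl).mono (le_completion (past_le _)) le_rfl
  · rw [hℱ, ht] at hS
    rw [measure_pairAt_inter (M + k) x hS, ENNReal.coe_inv (by simp), ENNReal.coe_natCast]
    rfl
  · rw [ENNReal.coe_inv (by simp), ENNReal.coe_natCast]
    refine le_trans (mul_le_mul_right ?_ _) (inv_card_alphabet_le M k)
    exact_mod_cast ncard_pairs_le (M + k) x x' y y' hne
  · refine (measure_mono (t := (fun ω : Source => ω (M + k, true)) ⁻¹' {x.1}) ?_).trans ?_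
    · rintro ω rfl
      rfl
    · rw [measure_source_apply]
      refine le_trans ?_ ((inv_card_alphabet_le M k).trans
        (pow_le_pow_right_of_le_one' (ENNReal.inv_le_one.2 one_le_two) (by omega)))
      exact le_mul_of_one_le_right' (by norm_num)
  · refine le_trans (add_le_add ?_ le_rfl) (sum_inv_two_pow (N + 1)).le
    exact le_rfl

theorem isStandard_reindex_process_iff (hφ : StrictMono φ) :
    IsStandard sourceMeasure (reindex (naturalFiltration sourceMeasure process) φ hφ.monotone) ↔
      {n : NonposInt | n.odd ∉ range φ}.Infinite :=
  ⟨fun h => by_contra fun hn => not_isStandard_reindex_process hφ hn h,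
    fun h => (isProductType_reindex_process hφ h).isStandard⟩

theorem NonposInt.odd_strictMono : StrictMono NonposInt.odd := by
  intro a b h
  have h' : a.1 < b.1 := h
  change 2 * a.1 - 1 < 2 * b.1 - 1
  omega

theorem isAtThreshold_process : IsAtThreshold sourceMeasure
    (reindex (naturalFiltration sourceMeasure process) NonposInt.odd NonposInt.odd_mono) := by
  refine ⟨not_isStandard_reindex_process NonposInt.odd_strictMono (by simp), fun D _ => ?_⟩
  -- Extracting along `D` from the odd times is reading the full filtration along a composite map,
  -- whose missed odd times correspond to the complement of `D`.
  have h := isStandard_reindex_process_iff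
    (NonposInt.odd_strictMono.comp (fun _ _ h => h : StrictMono (Subtype.val : D → NonposInt)))
  have hD : {n : NonposInt | n.odd ∉ range (NonposInt.odd ∘ (Subtype.val : D → NonposInt))} =
      Dᶜ := by
    ext n
    simp only [range_comp, Subtype.range_coe, mem_ofPred_eq, mem_compl_iff,
      NonposInt.odd_strictMono.injective.mem_set_image]
  rw [hD] at h
  exact h

end Extraction

end BackwardFiltration


theorem mainTheorem1 :
    ∃ (Ω : Type) (_ : MeasurableSpace Ω) (μ : Measure Ω) (_ : IsProbabilityMeasure μ)
      (E : NonposInt → Type) (_ : ∀ n, Finite (E n))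
      (_ : ∀ n, MeasurableSpace (E n)) (_ : ∀ n, DiscreteMeasurableSpace (E n))
      (Z : ∀ n, Ω → E n),
      (∀ n, Measurable (Z n)) ∧
      IsMarkov μ Z ∧
      iIndepFun (fun n : NonposInt => Z n.even) μ ∧
      (∀ n : NonposInt, ∃ g : E n.evenPrev × E n.even → E n.odd,
        ∀ ω, Z n.odd ω = g (Z n.evenPrev ω, Z n.even ω)) ∧
      (∃ r : NonposInt → ℕ, IsAdicFiltration μ (naturalFiltration μ Z) r) ∧
      (∀ D : Set NonposInt, D.Infinite →
        (IsStandard μ (extract (naturalFiltration μ Z) D) ↔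
          {n : NonposInt | n.odd ∉ D}.Infinite)) ∧
      IsAtThreshold μ
        (reindex (naturalFiltration μ Z) NonposInt.odd NonposInt.odd_mono) := by
  refine ⟨Source, inferInstance, sourceMeasure, inferInstance,
    fun n => State (n.1.natAbs / 2), fun _ => inferInstance, fun _ => inferInstance,
    fun _ => inferInstance, process, measurable_process, isMarkov_process,
    iIndepFun_process_even, exists_process_odd_eq, ⟨_, isAdicFiltration_process⟩,
    fun D _ => ?_, isAtThreshold_process⟩
  have h := isStandard_reindex_process_iff (φ := (Subtype.val : D → NonposInt)) fun _ _ h => h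
  rw [Subtype.range_coe] at h
  exact h
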